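/- **Skyline bound, no source, many targets.** There are $U$ users and $T$ tasks. User $u$ has an unknown vector $\theta^u\in\mathbb R^n$ with $\|\theta^u\|_2\le 1$, task $t$ has a matrix $B_t\in\mathbb R^{b\times n}$, and $\|B_t\theta^u\|_2\le 1$ for all $t,u$. In round $h$ the agent observes a context $(u_h,t_h)\in[U]\times[T]$ and a finite non-empty decision set $\mathcal A_h\subset\mathbb R^b$ of arms of Euclidean norm at most $1$ (contexts and decision sets may be random and may depend on the past; the sizes $|\mathcal A_h|$ are uniformly bounded), pulls $x_h\in\mathcal A_h$ and receives $X_h=\langle x_h,B_{t_h}\theta^{u_h}\rangle+\eta_h$, where $\eta_h$ is mean-zero, $1$-subgaussian and independent of everything that precedes it. The regret is $$R_H=\mathbb E\Big[\sum_{h=1}^H\max_{x\in\mathcal A_h}\langle x,B_{t_h}\theta^{u_h}\rangle-\sum_{h=1}^H X_h\Big].$$ Low-rank structure: there are matrices $U_t\in\mathbb R^{b\times r}$, known to the agent, and unknown vectors $\varphi^u\in\mathbb R^r$ with $B_t\theta^u=U_t\varphi^u$ for all $t,u$. *The agent.* For each user $u$ it runs a separate $r$-dimensional LinUCB on the transformed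 arms $U_{t}^{\top}x$, regularised by a positive definite matrix $\Lambda\in\mathbb R^{r\times r}$. That is, if user $u=u_h$ was served in $k$ earlier rounds $s$, with features $a_s=U_{t_s}^\top x_s$, put $V=\Lambda+\sum_s a_sa_s^\top$, $\hat\varphi=V^{-1}\sum_s X_sa_s$ and $\rho=1+\sqrt{2\log (k+1)^2+\log(\det V/\det\Lambda)}$; the agent pulls an arm $x\in\mathcal A_h$ maximising $\langle z,\hat\varphi\rangle+\rho\sqrt{z^\top V^{-1}z}$ with $z=U_{t_h}^\top x$, ties being broken arbitrarily without use of the future. *Claim.* For every $c>1$ there is a constant $C$, depending on $c$ only, such that for all $n,b,r,T$ and $B_1,\dots,B_T$: 1. If the stacked matrix $(B_1;\dots;B_T)$ has rank at most $r$, then there are $U_t\in\mathbb R^{b\times r}$ and $W\in\mathbb R^{r\times n}$ with $B_t=U_tW$ for all $t$, so that matrices $U_t$ as above can be found from the task matrices alone (with $\varphi^u=W\theta^u$). 2. For all matrices $U_1,\dots,U_T\in\mathbb R^{b\times r}$ there is a positive definite $\Lambda$ (chosen from the task matrices alone, before and independently of $U$, the $\theta^u,\varphi^u$, the contexts, the decision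 sets, the noise and the horizon) such that in every instance as above the described agent exists, and each such agent satisfies, for every $H\ge cU$, $$R_H\le C\,r\sqrt{UH}\,\log\frac HU ,$$ the random variable whose expectation is $R_H$ being integrable. -/

import Mathlib

open MeasureTheory ProbabilityTheory Matrix

namespace SkylineBandit

noncomputable section

/-- The task matrices stacked on top of each other, one block of `b` rows per task. -/
def stack {T b n : ℕ} (B : Fin T → Matrix (Fin b) (Fin n) ℝ) :
    Matrix (Fin T × Fin b) (Fin n) ℝ :=
  Matrix.of fun p j => B p.1 p.2 j

/-! ### LinUCB in dimension `r`

The data of one learner are the rounds `S` it has played so far, the features `a s` of the arms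
pulled in these rounds and the rewards `X s` received. -/

/-- The regularised Gram matrix `V = Λ + ∑ a aᵀ`. -/
def gram {r : ℕ} (Λ : Matrix (Fin r) (Fin r) ℝ) (S : Finset ℕ) (a : ℕ → Fin r → ℝ) :
    Matrix (Fin r) (Fin r) ℝ :=
  Λ + ∑ s ∈ S, vecMulVec (a s) (a s)

/-- The regularised least-squares estimate `V⁻¹ ∑ X a`. -/
def estimate {r : ℕ} (Λ : Matrix (Fin r) (Fin r) ℝ) (S : Finset ℕ) (a : ℕ → Fin r → ℝ)
    (X : ℕ → ℝ) : Fin r → ℝ :=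
  (gram Λ S a)⁻¹ *ᵥ ∑ s ∈ S, X s • a s

/-- The radius `1 + √(2 log (1/δ) + log (det V / det Λ))` of the confidence ellipsoid, at the
confidence level `δ = (k + 1)⁻²` after `k` rounds. No horizon is used. -/
def radius {r : ℕ} (Λ : Matrix (Fin r) (Fin r) ℝ) (S : Finset ℕ) (a : ℕ → Fin r → ℝ) : ℝ :=
  1 + √(2 * Real.log (((S.card : ℝ) + 1) ^ 2) + Real.log ((gram Λ S a).det / Λ.det))

/-- The upper confidence bound of an arm with feature `z`, that is, the maximum of `⟨z, ψ⟩` over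
the ellipsoid of the `ψ` at `V`-distance at most `radius` from the estimate. -/
def ucb {r : ℕ} (Λ : Matrix (Fin r) (Fin r) ℝ) (S : Finset ℕ) (a : ℕ → Fin r → ℝ)
    (X : ℕ → ℝ) (z : Fin r → ℝ) : ℝ :=
  z ⬝ᵥ estimate Λ S a X + radius Λ S a * √(z ⬝ᵥ ((gram Λ S a)⁻¹ *ᵥ z))

/-! ### The bandit problem with many users and many tasks -/

/-- The expected reward `⟨x, B_t θ^u⟩` of the arm `x` for user `u` and task `t`. -/
def meanReward {T b n U : ℕ} (B : Fin T → Matrix (Fin b) (Fin n) ℝ) (θ : Fin U → Fin n → ℝ)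
    (u : Fin U) (t : Fin T) (x : Fin b → ℝ) : ℝ :=
  x ⬝ᵥ (B t *ᵥ θ u)

/-- The standing assumptions. Rounds are numbered from `0`. The σ-algebra `ℱ h` describes what has
happened before the reward of round `h` is drawn: the context `(user h, task h)` and the decision
set `{arm h i | i}` are known then and may be random and depend on the past; the noise `η h` is
independent of it. A `1`-subgaussian variable in the sense of `HasSubgaussianMGF` has mean zero.
Norms are Euclidean. -/
structure IsInstance {Ω : Type*} [mΩ : MeasurableSpace Ω] (μ : Measure Ω) (ℱ : Filtration ℕ mΩ)
    {n b r T U K : ℕ} (B : Fin T → Matrix (Fin b) (Fin n) ℝ)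
    (𝒰 : Fin T → Matrix (Fin b) (Fin r) ℝ) (θ : Fin U → Fin n → ℝ) (φ : Fin U → Fin r → ℝ)
    (user : ℕ → Ω → Fin U) (task : ℕ → Ω → Fin T) (arm : ℕ → Ω → Fin K → Fin b → ℝ)
    (η : ℕ → Ω → ℝ) : Prop where
  low_rank : ∀ t u, B t *ᵥ θ u = 𝒰 t *ᵥ φ u
  norm_theta_le : ∀ u, ‖WithLp.toLp 2 (θ u)‖ ≤ 1
  norm_param_le : ∀ t u, ‖WithLp.toLp 2 (B t *ᵥ θ u)‖ ≤ 1
  norm_arm_le : ∀ h ω i, ‖WithLp.toLp 2 (arm h ω i)‖ ≤ 1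
  measurable_user : ∀ h, Measurable[ℱ h] (user h)
  measurable_task : ∀ h, Measurable[ℱ h] (task h)
  measurable_arm : ∀ h i, Measurable[ℱ h] fun ω => arm h ω i
  measurable_noise : ∀ h, Measurable[ℱ (h + 1)] (η h)
  indep_noise : ∀ h, Indep (MeasurableSpace.comap (η h) inferInstance) (ℱ h) μ
  subgaussian_noise : ∀ h, HasSubgaussianMGF (η h) 1 μ

/-- The reward `X_h = ⟨x_h, B_t θ^u⟩ + η_h` at the context `(u, t)` of round `h`, if the agent
pulls the arm `x_h` with number `I h`. -/
def reward {Ω : Type*} {n b T U K : ℕ} (B : Fin T → Matrix (Fin b) (Fin n) ℝ)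
    (θ : Fin U → Fin n → ℝ) (user : ℕ → Ω → Fin U) (task : ℕ → Ω → Fin T)
    (arm : ℕ → Ω → Fin K → Fin b → ℝ) (η : ℕ → Ω → ℝ) (I : ℕ → Ω → Fin K)
    (h : ℕ) (ω : Ω) : ℝ :=
  meanReward B θ (user h ω) (task h ω) (arm h ω (I h ω)) + η h ω

/-- The transformed arm `(U_t)ᵀ x`, for the task `t` of round `h` and the arm `x` number `i`. -/
def feature {Ω : Type*} {b r T K : ℕ} (𝒰 : Fin T → Matrix (Fin b) (Fin r) ℝ)
    (task : ℕ → Ω → Fin T) (arm : ℕ → Ω → Fin K → Fin b → ℝ) (h : ℕ) (ω : Ω) (i : Fin K) :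
    Fin r → ℝ :=
  (𝒰 (task h ω))ᵀ *ᵥ arm h ω i

/-- The rounds before `h` in which the user of round `h` was served. -/
def pastRounds {Ω : Type*} {U : ℕ} (user : ℕ → Ω → Fin U) (h : ℕ) (ω : Ω) : Finset ℕ :=
  (Finset.range h).filter fun s => user s ω = user h ω

/-- `I` (the number of the arm pulled in each round) is the choice of the agent that runs a separate
`r`-dimensional LinUCB with regulariser `Λ` for each user, on the transformed arms. Ties may be
broken in any non-anticipating way. -/
structure IsPerUserLinUCB {Ω : Type*} [mΩ : MeasurableSpace Ω] (ℱ : Filtration ℕ mΩ)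
    {n b r T U K : ℕ} (Λ : Matrix (Fin r) (Fin r) ℝ) (B : Fin T → Matrix (Fin b) (Fin n) ℝ)
    (𝒰 : Fin T → Matrix (Fin b) (Fin r) ℝ) (θ : Fin U → Fin n → ℝ)
    (user : ℕ → Ω → Fin U) (task : ℕ → Ω → Fin T) (arm : ℕ → Ω → Fin K → Fin b → ℝ)
    (η : ℕ → Ω → ℝ) (I : ℕ → Ω → Fin K) : Prop where
  measurable_choice : ∀ h, Measurable[ℱ h] (I h)
  maximizes : ∀ h ω i,
    ucb Λ (pastRounds user h ω) (fun s => feature 𝒰 task arm s ω (I s ω))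
        (fun s => reward B θ user task arm η I s ω) (feature 𝒰 task arm h ω i) ≤
      ucb Λ (pastRounds user h ω) (fun s => feature 𝒰 task arm s ω (I s ω))
        (fun s => reward B θ user task arm η I s ω) (feature 𝒰 task arm h ω (I h ω))

/-- The best expected rewards minus the rewards received, summed over the rounds before `H`. The
regret `R_H` is the expectation of this random variable. -/
def pathRegret {Ω : Type*} {n b T U K : ℕ} (B : Fin T → Matrix (Fin b) (Fin n) ℝ)
    (θ : Fin U → Fin n → ℝ) (user : ℕ → Ω → Fin U) (task : ℕ → Ω → Fin T)
    (arm : ℕ → Ω → Fin K → Fin b → ℝ) (η : ℕ → Ω → ℝ) (I : ℕ → Ω → Fin K)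
    (H : ℕ) (ω : Ω) : ℝ :=
  ∑ h ∈ Finset.range H, (⨆ i, meanReward B θ (user h ω) (task h ω) (arm h ω i)) -
    ∑ h ∈ Finset.range H, reward B θ user task arm η I h ω

end

end SkylineBandit

namespace SkylineBandit

open scoped ENNReal NNReal

/-! Each user is an `r`-dimensional linear bandit, and LinUCB costs about `r √k log (r² k)` over `k`
rounds. The obstacle is scale: neither `U_t` nor `φ^u` is bounded, and only the products `⟨U_tᵀ x,
φ^u⟩`, which are mean rewards, are known to lie in `[-1, 1]`. The regulariser must therefore be
fitted to the geometry of the features. The set of all possible features is compact, so it has a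
spanner `M` (`exists_spanner`), obtained by maximising `|det|`. In its coordinates every feature has
entries in `[-1, 1]`, and so does a parameter `ψ` indistinguishable from `φ^u` on the features. With
`Λ = r⁻¹ Mᵀ M` this gives `ψᵀ Λ ψ ≤ 1` and `det V / det Λ ≤ (r² (1 + k))^r`, whatever the scale
(`exists_regularizer`).

The confidence ellipsoids are valid by the method of mixtures: `√(det Λ / det V) exp (‖∑ η a‖² /
2)`, in the norm of `V⁻¹`, has expectation at most `1` (`lintegral_mixture_le_one`). This is proved
by one-dimensional Gaussian mixing at each step. The rounds of a user occur at random times. Setting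
to zero all features except those of the first `k` rounds of the user keeps the features
predictable, so a deterministic horizon and Markov's inequality suffice, without stopping times.
Failure after `k` rounds has probability at most `(k + 1)⁻²` and costs at most `2`, hence at most
`4` per user in expectation. On the remaining rounds the elliptical potential and Cauchy–Schwarz
give the regret (`sum_gap_user_le`).

Summing over users, a concavity argument replaces each `k_u` by the average `N = H / U`
(`sum_sqrt_mul_log_le`). The unwanted `log r` is removed in `final_bound`: for `r ≤ N` it is
absorbed by `log N`, and for `r ≥ N` the trivial bound `2 H` is already small enough. The assumption
`c > 1` keeps `log N` away from zero, so that additive constants can be absorbed. -/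

/-- Cauchy–Schwarz for the form of a positive semidefinite matrix. -/
lemma sq_dotProduct_mulVec_le {ι : Type*} [Fintype ι] {A : Matrix ι ι ℝ} (hA : A.PosSemidef)
    (x y : ι → ℝ) : (x ⬝ᵥ A *ᵥ y) ^ 2 ≤ (x ⬝ᵥ A *ᵥ x) * (y ⬝ᵥ A *ᵥ y) := by
  have hsymm : y ⬝ᵥ A *ᵥ x = x ⬝ᵥ A *ᵥ y := by
    rw [dotProduct_mulVec, ← mulVec_transpose, dotProduct_comm]
    congr 2
    simpa [IsHermitian] using hA.1
  have h : ∀ t : ℝ, 0 ≤ (y ⬝ᵥ A *ᵥ y) * (t * t) + (2 * (x ⬝ᵥ A *ᵥ y)) * t + x ⬝ᵥ A *ᵥ x := by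
    intro t
    have := hA.dotProduct_mulVec_nonneg (x + t • y)
    simp only [star_trivial, mulVec_add, mulVec_smul, dotProduct_add, add_dotProduct,
      smul_dotProduct, dotProduct_smul, smul_eq_mul, hsymm] at this
    linarith
  have := discrim_le_zero h
  unfold discrim at this
  linarith

/-! ### Rank factorisation of the stacked matrix -/

/-- The column space embeds linearly into `ℝ^r` by some `j`, which has a left inverse `g`. Then `W`
is `A` followed by `j`, and `P` is `g`. -/
lemma exists_eq_mul_of_rank_le {ι κ : Type*} [Fintype ι] [DecidableEq ι] [Fintype κ]
    [DecidableEq κ] (A : Matrix ι κ ℝ) {r : ℕ} (h : A.rank ≤ r) :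
    ∃ (P : Matrix ι (Fin r) ℝ) (W : Matrix (Fin r) κ ℝ), A = P * W := by
  obtain ⟨j, hj⟩ : ∃ j : LinearMap.range A.mulVecLin →ₗ[ℝ] Fin r → ℝ, Function.Injective j := by
    have h : Module.finrank ℝ (LinearMap.range A.mulVecLin) ≤ r := h
    refine ⟨Function.ExtendByZero.linearMap ℝ (Fin.castLE h) ∘ₗ
      (Module.finBasis ℝ (LinearMap.range A.mulVecLin)).equivFun.toLinearMap, ?_⟩
    rw [LinearMap.coe_comp]
    refine Function.Injective.comp (fun x y hxy => ?_) (LinearEquiv.injective _)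
    ext i
    have := congrFun hxy (Fin.castLE h i)
    change Function.extend (Fin.castLE h) x 0 _ = Function.extend (Fin.castLE h) y 0 _ at this
    rwa [(Fin.castLE_injective h).extend_apply, (Fin.castLE_injective h).extend_apply] at this
  obtain ⟨g, hg⟩ := j.exists_leftInverse_of_injective (LinearMap.ker_eq_bot.2 hj)
  refine ⟨LinearMap.toMatrix' ((LinearMap.range A.mulVecLin).subtype ∘ₗ g),
    LinearMap.toMatrix' (j ∘ₗ A.mulVecLin.rangeRestrict), ?_⟩
  rw [← LinearMap.toMatrix'_comp]
  have : ((LinearMap.range A.mulVecLin).subtype ∘ₗ g) ∘ₗ (j ∘ₗ A.mulVecLin.rangeRestrict)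
      = A.mulVecLin := by
    ext1 x
    have := LinearMap.congr_fun hg
    simp only [LinearMap.comp_apply, LinearMap.id_apply] at this
    ext i
    simp [this]
  rw [this]
  simp [← Matrix.toLin'_apply']

lemma exists_factor_of_rank_stack_le {T b n r : ℕ} (B : Fin T → Matrix (Fin b) (Fin n) ℝ)
    (h : (stack B).rank ≤ r) :
    ∃ (𝒰 : Fin T → Matrix (Fin b) (Fin r) ℝ) (W : Matrix (Fin r) (Fin n) ℝ),
      ∀ t, B t = 𝒰 t * W := by
  obtain ⟨P, W, hPW⟩ := exists_eq_mul_of_rank_le _ h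
  refine ⟨fun t => Matrix.of fun i k => P (t, i) k, W, fun t => ?_⟩
  ext i j
  have := congrFun (congrFun hPW (t, i)) j
  simpa [stack, Matrix.mul_apply] using this

/-! ### A spanner of a compact set -/

/-- Cramer's rule: the coefficient of `a` on row `i` is a ratio of determinants, so maximality of
`|det|` will bound it by `1`. -/
lemma det_updateRow_eq {r : ℕ} (M : Matrix (Fin r) (Fin r) ℝ) (hM : M.det ≠ 0) (i : Fin r)
    (a : Fin r → ℝ) : (M.updateRow i a).det = M.det * ((Mᵀ)⁻¹ *ᵥ a) i := by
  rw [← cramer_transpose_apply, ← det_transpose M,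
    ← det_smul_inv_mulVec_eq_cramer Mᵀ a (by simpa using hM)]
  simp

/-- A compact set of vectors has a spanner: an invertible matrix such that every vector of the set
is a combination of the rows with coefficients in `[-1, 1]`, where the rows outside the set are not
used. -/
lemma exists_spanner {r : ℕ} {A : Set (Fin r → ℝ)} (hA : IsCompact A) :
    ∃ M : Matrix (Fin r) (Fin r) ℝ, M.det ≠ 0 ∧
      (∀ a ∈ A, ∀ i, |((Mᵀ)⁻¹ *ᵥ a) i| ≤ 1) ∧
      ∀ i, M i ∈ A ∨ ∀ a ∈ A, ((Mᵀ)⁻¹ *ᵥ a) i = 0 := by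
  classical
  let p : Finset (Fin r) → Prop := fun J =>
    ∃ M : Matrix (Fin r) (Fin r) ℝ, M.det ≠ 0 ∧ ∀ i ∈ J, M i ∈ A
  -- `A` need not span. `J` is a largest set of rows of an invertible matrix that can be taken from
  -- `A`; by maximality no vector of `A` has a component along the other rows.
  obtain ⟨J, hJ, hJmax⟩ : ∃ J, p J ∧ ∀ J', p J' → J'.card ≤ J.card := by
    have hne : (Finset.univ.filter p).Nonempty := ⟨∅, by simp [p]; exact ⟨1, by simp⟩⟩
    obtain ⟨J, hJ, h⟩ := Finset.exists_max_image _ Finset.card hne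
    exact ⟨J, by simpa using hJ, fun J' hJ' => h J' (by simpa using hJ')⟩
  obtain ⟨M₀, hM₀, hM₀A⟩ := hJ
  -- The rows outside `J` are frozen, so that the determinant is maximised over a compact product.
  let s : Fin r → Set (Fin r → ℝ) := fun i => if i ∈ J then A else {M₀ i}
  have hs : ∀ i, IsCompact (s i) := fun i => by
    by_cases h : i ∈ J
    · simpa [s, h] using hA
    · simp [s, h]
  let Q : Set (Matrix (Fin r) (Fin r) ℝ) := {M | ∀ i, M i ∈ s i}
  have hQ : IsCompact Q := by
    have : Q = Set.univ.pi s := Set.ext fun M => (Set.mem_univ_pi (f := M)).symm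
    rw [this]
    exact isCompact_univ_pi hs
  have hmem : M₀ ∈ Q := fun i => by
    by_cases h : i ∈ J
    · simpa [s, h] using hM₀A i h
    · simp [s, h]
  have hcont : Continuous fun M : Matrix (Fin r) (Fin r) ℝ => |M.det| :=
    (Continuous.matrix_det continuous_id).abs
  obtain ⟨M, hM, hmax⟩ := hQ.exists_isMaxOn ⟨_, hmem⟩ hcont.continuousOn
  have hMdet : M.det ≠ 0 := by
    have : |M₀.det| ≤ |M.det| := hmax hmem
    exact abs_pos.1 (lt_of_lt_of_le (abs_pos.2 hM₀) this)
  have hMA : ∀ i ∈ J, M i ∈ A := fun i hi => by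
    have := hM i
    simpa [s, hi] using this
  have hout : ∀ i ∉ J, ∀ a ∈ A, ((Mᵀ)⁻¹ *ᵥ a) i = 0 := by
    intro i hi a ha
    by_contra hne
    have : p (insert i J) := by
      refine ⟨M.updateRow i a, ?_, ?_⟩
      · rw [det_updateRow_eq _ hMdet]
        exact mul_ne_zero hMdet hne
      · intro j hj
        by_cases hji : j = i
        · subst hji; simpa [updateRow_self] using ha
        · rw [updateRow_ne hji]
          exact hMA j (Finset.mem_of_mem_insert_of_ne hj hji)
    have := hJmax _ this
    rw [Finset.card_insert_of_notMem hi] at this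
    omega
  refine ⟨M, hMdet, fun a ha i => ?_, fun i => ?_⟩
  · by_cases hi : i ∈ J
    · have hmem' : M.updateRow i a ∈ Q := by
        intro j
        by_cases hji : j = i
        · subst hji; simpa [s, hi] using ha
        · rw [updateRow_ne hji]; exact hM j
      have : |(M.updateRow i a).det| ≤ |M.det| := hmax hmem'
      rw [det_updateRow_eq _ hMdet, abs_mul] at this
      have hpos := abs_pos.2 hMdet
      by_contra hlt
      push Not at hlt
      nlinarith
    · rw [hout i hi a ha]; simp
  · by_cases hi : i ∈ J
    · exact Or.inl (hMA i hi)
    · exact Or.inr (hout i hi)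

lemma vecMulVec_mulVec_transpose {r : ℕ} (M : Matrix (Fin r) (Fin r) ℝ) (c : Fin r → ℝ) :
    vecMulVec (Mᵀ *ᵥ c) (Mᵀ *ᵥ c) = Mᵀ * vecMulVec c c * M := by
  rw [mul_vecMulVec, vecMulVec_mul, mulVec_transpose]

/-- A regulariser adapted to a compact set of features. -/
lemma exists_regularizer {r : ℕ} (hr : 0 < r) {A : Set (Fin r → ℝ)} (hA : IsCompact A) :
    ∃ Λ : Matrix (Fin r) (Fin r) ℝ, Λ.PosDef ∧
      (∀ φ : Fin r → ℝ, (∀ a ∈ A, |a ⬝ᵥ φ| ≤ 1) →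
        ∃ ψ : Fin r → ℝ, (∀ a ∈ A, a ⬝ᵥ φ = a ⬝ᵥ ψ) ∧ ψ ⬝ᵥ Λ *ᵥ ψ ≤ 1) ∧
      ∀ (S : Finset ℕ) (a : ℕ → Fin r → ℝ), (∀ s ∈ S, a s ∈ A) →
        (gram Λ S a).det / Λ.det ≤ ((r : ℝ) ^ 2 * (1 + S.card)) ^ r := by
  obtain ⟨M, hM, hle, hor⟩ := exists_spanner hA
  have hMu : IsUnit M.det := isUnit_iff_ne_zero.2 hM
  have hMtu : IsUnit (Mᵀ).det := by simpa using hMu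
  have hr' : (0 : ℝ) < r := by exact_mod_cast hr
  have hr1 : (1 : ℝ) ≤ r := by exact_mod_cast hr
  have hcoef : ∀ a, Mᵀ *ᵥ ((Mᵀ)⁻¹ *ᵥ a) = a := fun a => by
    rw [mulVec_mulVec, mul_nonsing_inv _ hMtu, one_mulVec]
  have hΛ : ((r : ℝ)⁻¹ • (Mᵀ * M)).PosDef := by
    refine PosDef.smul ?_ (inv_pos.2 hr')
    have := PosDef.conjTranspose_mul_self M
      (mulVec_injective_iff_isUnit.2 ((isUnit_iff_isUnit_det M).2 hMu))
    simpa using this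
  refine ⟨(r : ℝ)⁻¹ • (Mᵀ * M), hΛ, fun φ hφ => ?_, fun S a ha => ?_⟩
  · classical
    -- `φ` is uncontrolled on the rows outside `A`, so `ψ` is made to vanish there. This changes no
    -- value on `A`, since those rows have coefficient zero.
    let d : Fin r → ℝ := fun i => if M i ∈ A then M i ⬝ᵥ φ else 0
    have hMψ : M *ᵥ (M⁻¹ *ᵥ d) = d := by
      rw [mulVec_mulVec, mul_nonsing_inv _ hMu, one_mulVec]
    refine ⟨M⁻¹ *ᵥ d, fun a ha => ?_, ?_⟩
    · have key : ∀ v, a ⬝ᵥ v = ((Mᵀ)⁻¹ *ᵥ a) ⬝ᵥ (M *ᵥ v) := fun v => by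
        conv_lhs => rw [← hcoef a]
        rw [mulVec_transpose, ← dotProduct_mulVec]
      rw [key, key, hMψ]
      refine Finset.sum_congr rfl fun i _ => ?_
      rcases hor i with h | h
      · simp [d, h, mulVec]
      · simp [h a ha]
    · rw [smul_mulVec, dotProduct_smul, ← mulVec_mulVec, dotProduct_mulVec, vecMul_transpose, hMψ]
      have : d ⬝ᵥ d ≤ r := by
        have : d ⬝ᵥ d ≤ ∑ _i : Fin r, (1 : ℝ) := by
          refine Finset.sum_le_sum fun i _ => ?_
          by_cases h : M i ∈ A
          · have := abs_le.1 (hφ _ h)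
            simp only [d, h, if_true]
            nlinarith
          · simp [d, h]
        simpa using this
      rw [smul_eq_mul, inv_mul_le_iff₀ hr']
      linarith
  · set c : ℕ → Fin r → ℝ := fun s => (Mᵀ)⁻¹ *ᵥ a s with hc
    -- The Gram matrix in spanner coordinates. The factor `det M ^ 2` cancels in the ratio, and `det
    -- N` is bounded through its entries by `r! x ^ r` with `r! ≤ r ^ r`.
    set N : Matrix (Fin r) (Fin r) ℝ := (r : ℝ)⁻¹ • 1 + ∑ s ∈ S, vecMulVec (c s) (c s) with hN
    have hgram : gram ((r : ℝ)⁻¹ • (Mᵀ * M)) S a = Mᵀ * N * M := by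
      rw [gram, hN, mul_add, add_mul, Finset.mul_sum, Finset.sum_mul]
      congr 1
      · simp
      · refine Finset.sum_congr rfl fun s _ => ?_
        rw [← vecMulVec_mulVec_transpose, hcoef]
    have hNle : N.det ≤ ((r : ℝ) * ((r : ℝ)⁻¹ + S.card)) ^ r := by
      have hent : ∀ i j, AbsoluteValue.abs (N i j) ≤ (r : ℝ)⁻¹ + S.card := by
        intro i j
        rw [AbsoluteValue.abs_apply, hN, Matrix.add_apply, Matrix.sum_apply]
        refine (abs_add_le _ _).trans (add_le_add ?_ ?_)
        · rw [Matrix.smul_apply, one_apply]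
          split_ifs
          · simp
          · simp
        · refine (Finset.abs_sum_le_sum_abs _ _).trans ?_
          rw [Finset.card_eq_sum_ones, Nat.cast_sum]
          refine Finset.sum_le_sum fun s hs => ?_
          rw [vecMulVec_apply, abs_mul, Nat.cast_one]
          exact mul_le_one₀ (hle _ (ha s hs) i) (abs_nonneg _) (hle _ (ha s hs) j)
      have := det_le hent
      rw [AbsoluteValue.abs_apply, Fintype.card_fin, nsmul_eq_mul] at this
      refine (le_abs_self _).trans (this.trans ?_)
      rw [mul_pow]
      gcongr
      exact_mod_cast Nat.factorial_le_pow r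
    have hΛdet : ((r : ℝ)⁻¹ • (Mᵀ * M)).det = ((r : ℝ)⁻¹) ^ r * (M.det * M.det) := by
      rw [det_smul, det_mul, det_transpose, Fintype.card_fin]
    rw [hgram, hΛdet, det_mul, det_mul, det_transpose]
    have hMM : M.det * M.det ≠ 0 := mul_ne_zero hM hM
    have : M.det * N.det * M.det / ((r : ℝ)⁻¹ ^ r * (M.det * M.det)) = (r : ℝ) ^ r * N.det := by
      rw [inv_pow]
      field_simp
    rw [this]
    calc (r : ℝ) ^ r * N.det ≤ (r : ℝ) ^ r * ((r : ℝ) * ((r : ℝ)⁻¹ + S.card)) ^ r := by gcongr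
      _ = (r + (r : ℝ) ^ 2 * S.card) ^ r := by
        rw [← mul_pow]; congr 1; field_simp
      _ ≤ _ := by
        gcongr
        nlinarith

/-! ### Rank-one updates -/

lemma gram_posDef {r : ℕ} {Λ : Matrix (Fin r) (Fin r) ℝ} (hΛ : Λ.PosDef) (S : Finset ℕ)
    (a : ℕ → Fin r → ℝ) : (gram Λ S a).PosDef := by
  refine hΛ.add_posSemidef (posSemidef_sum _ fun s _ => ?_)
  simpa using posSemidef_vecMulVec_self_star (a s)

lemma gram_range_succ {r : ℕ} (Λ : Matrix (Fin r) (Fin r) ℝ) (a : ℕ → Fin r → ℝ) (h : ℕ) :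
    gram Λ (Finset.range (h + 1)) a = gram Λ (Finset.range h) a + vecMulVec (a h) (a h) := by
  rw [gram, gram, Finset.sum_range_succ, add_assoc]

lemma inv_quadForm_nonneg {r : ℕ} {V : Matrix (Fin r) (Fin r) ℝ} (hV : V.PosDef)
    (b : Fin r → ℝ) : 0 ≤ b ⬝ᵥ V⁻¹ *ᵥ b := by
  simpa using hV.inv.posSemidef.dotProduct_mulVec_nonneg b

lemma det_add_vecMulVec_self {r : ℕ} {V : Matrix (Fin r) (Fin r) ℝ} (hV : V.PosDef)
    (b : Fin r → ℝ) : (V + vecMulVec b b).det = V.det * (1 + b ⬝ᵥ V⁻¹ *ᵥ b) := by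
  have h := det_add_replicateCol_mul_replicateRow (ι := Unit) (A := V)
    ((isUnit_iff_isUnit_det V).1 hV.isUnit) b b
  rw [← vecMulVec_eq] at h
  rw [h]
  congr 1
  rw [det_unique, Matrix.add_apply, one_apply_eq, Matrix.mul_assoc, ← replicateCol_mulVec,
    replicateRow_mul_replicateCol_apply]

/-- A Sherman–Morrison computation. The increment is, apart from the logarithm and the factor `1 /
2`, the exponent of `stepFactor`. -/
lemma inv_quadForm_update {r : ℕ} {V : Matrix (Fin r) (Fin r) ℝ} (hV : V.PosDef)
    (b S : Fin r → ℝ) (η : ℝ) :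
    (S + η • b) ⬝ᵥ (V + vecMulVec b b)⁻¹ *ᵥ (S + η • b) = S ⬝ᵥ V⁻¹ *ᵥ S +
      (2 * η * (b ⬝ᵥ V⁻¹ *ᵥ S) + η ^ 2 * (b ⬝ᵥ V⁻¹ *ᵥ b) - (b ⬝ᵥ V⁻¹ *ᵥ S) ^ 2) /
        (1 + b ⬝ᵥ V⁻¹ *ᵥ b) := by
  have hw := inv_quadForm_nonneg hV b
  have hVu := (isUnit_iff_isUnit_det V).1 hV.isUnit
  have hV' : (V + vecMulVec b b).PosDef :=
    hV.add_posSemidef (by simpa using posSemidef_vecMulVec_self_star b)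
  have hVu' := (isUnit_iff_isUnit_det _).1 hV'.isUnit
  have hsymm : S ⬝ᵥ V⁻¹ *ᵥ b = b ⬝ᵥ V⁻¹ *ᵥ S := by
    rw [dotProduct_mulVec, ← mulVec_transpose, dotProduct_comm]
    congr 2
    simpa [IsHermitian] using hV.inv.1
  set w := b ⬝ᵥ V⁻¹ *ᵥ b with hwdef
  set α := b ⬝ᵥ V⁻¹ *ᵥ S with hα
  -- The solution of the updated linear system is guessed as a combination of `V⁻¹ S` and `V⁻¹ b`
  -- and then checked.
  have hsol : (V + vecMulVec b b)⁻¹ *ᵥ (S + η • b) =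
      V⁻¹ *ᵥ S + ((η - α) / (1 + w)) • V⁻¹ *ᵥ b := by
    have : (V + vecMulVec b b) *ᵥ (V⁻¹ *ᵥ S + ((η - α) / (1 + w)) • V⁻¹ *ᵥ b) = S + η • b := by
      rw [add_mulVec, mulVec_add, mulVec_smul, mulVec_mulVec, mulVec_mulVec,
        mul_nonsing_inv _ hVu, one_mulVec, one_mulVec, vecMulVec_mulVec, dotProduct_add,
        dotProduct_smul, ← hwdef, ← hα]
      ext i
      simp
      field_simp
      ring
    rw [← this, mulVec_mulVec, nonsing_inv_mul _ hVu', one_mulVec]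
  rw [hsol]
  simp only [dotProduct_add, add_dotProduct, smul_dotProduct, dotProduct_smul, smul_eq_mul, hsymm,
    ← hwdef, ← hα]
  field_simp
  ring

/-! ### Deterministic analysis of LinUCB -/

/-- Telescoping of the matrix determinant lemma `det_add_vecMulVec_self`. -/
lemma log_det_gram_div {r : ℕ} {Λ : Matrix (Fin r) (Fin r) ℝ} (hΛ : Λ.PosDef)
    (b : ℕ → Fin r → ℝ) (h : ℕ) :
    Real.log ((gram Λ (Finset.range h) b).det / Λ.det) =
      ∑ s ∈ Finset.range h, Real.log (1 + b s ⬝ᵥ (gram Λ (Finset.range s) b)⁻¹ *ᵥ b s) := by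
  induction h with
  | zero => simp [gram, hΛ.det_pos.ne']
  | succ h ih =>
    have hV := gram_posDef hΛ (Finset.range h) b
    have hw := inv_quadForm_nonneg hV (b h)
    rw [Finset.sum_range_succ, ← ih, gram_range_succ, det_add_vecMulVec_self hV, mul_div_right_comm,
      Real.log_mul (div_pos hV.det_pos hΛ.det_pos).ne' (by positivity)]

/-- A zero feature adds nothing to the Gram matrix. The rounds of one user can thus be treated as
all rounds, with zero features elsewhere. -/
lemma gram_filter {r : ℕ} (Λ : Matrix (Fin r) (Fin r) ℝ) (S : Finset ℕ) (P : ℕ → Prop)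
    [DecidablePred P] (a : ℕ → Fin r → ℝ) :
    gram Λ (S.filter P) a = gram Λ S fun s => if P s then a s else 0 := by
  rw [gram, gram, Finset.sum_filter]
  congr 1
  refine Finset.sum_congr rfl fun s _ => ?_
  split_ifs <;> simp

lemma min_one_le_two_mul_log {w : ℝ} (hw : 0 ≤ w) : min 1 w ≤ 2 * Real.log (1 + w) := by
  have h2 := Real.log_two_gt_d9
  rcases le_total 1 w with h | h
  · rw [min_eq_left h]
    have : Real.log 2 ≤ Real.log (1 + w) := Real.log_le_log (by norm_num) (by linarith)
    linarith
  · rw [min_eq_right h]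
    have h1 := Real.one_sub_inv_le_log_of_pos (show 0 < 1 + w by linarith)
    have h3 : w / 2 ≤ 1 - (1 + w)⁻¹ := by
      have : 1 - (1 + w)⁻¹ = w / (1 + w) := by field_simp; ring
      rw [this]
      exact div_le_div_of_nonneg_left hw (by linarith) (by linarith)
    linarith

/-- The elliptical potential lemma. -/
lemma sum_min_one_le {r : ℕ} {Λ : Matrix (Fin r) (Fin r) ℝ} (hΛ : Λ.PosDef) (P : ℕ → Prop)
    [DecidablePred P] (a : ℕ → Fin r → ℝ) (H : ℕ) :
    ∑ s ∈ (Finset.range H).filter P,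
        min 1 (a s ⬝ᵥ (gram Λ ((Finset.range s).filter P) a)⁻¹ *ᵥ a s) ≤
      2 * Real.log ((gram Λ ((Finset.range H).filter P) a).det / Λ.det) := by
  rw [gram_filter, log_det_gram_div hΛ, Finset.mul_sum, Finset.sum_filter]
  refine Finset.sum_le_sum fun s _ => ?_
  simp only [gram_filter]
  have := min_one_le_two_mul_log (inv_quadForm_nonneg
    (gram_posDef hΛ (Finset.range s) fun s => if P s then a s else 0) (if P s then a s else 0))
  split_ifs with hs
  · simpa [hs] using this
  · simp

lemma one_le_radius {r : ℕ} (Λ : Matrix (Fin r) (Fin r) ℝ) (S : Finset ℕ)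
    (a : ℕ → Fin r → ℝ) : 1 ≤ radius Λ S a :=
  le_add_of_nonneg_right (Real.sqrt_nonneg _)

/-- On the event that the noise is small in the self-normalised norm, the parameter lies in the
confidence ellipsoid. -/
lemma abs_dotProduct_estimate_sub_le {r : ℕ} {Λ : Matrix (Fin r) (Fin r) ℝ} (hΛ : Λ.PosDef)
    {S : Finset ℕ} {a : ℕ → Fin r → ℝ} {X η : ℕ → ℝ} {ψ : Fin r → ℝ}
    (hX : ∀ s ∈ S, X s = a s ⬝ᵥ ψ + η s) (hψ : ψ ⬝ᵥ Λ *ᵥ ψ ≤ 1)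
    (hη : (∑ s ∈ S, η s • a s) ⬝ᵥ (gram Λ S a)⁻¹ *ᵥ (∑ s ∈ S, η s • a s) ≤
      2 * Real.log (((S.card : ℝ) + 1) ^ 2) + Real.log ((gram Λ S a).det / Λ.det))
    (z : Fin r → ℝ) :
    |z ⬝ᵥ estimate Λ S a X - z ⬝ᵥ ψ| ≤ radius Λ S a * √(z ⬝ᵥ (gram Λ S a)⁻¹ *ᵥ z) := by
  have hV := gram_posDef hΛ S a
  have hVu := (isUnit_iff_isUnit_det _).1 hV.isUnit
  set V := gram Λ S a with hVdef
  set n := ∑ s ∈ S, η s • a s with hn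
  -- This splits the estimation error into noise `V⁻¹ n` and bias `V⁻¹ Λ ψ`.
  have hsum : ∑ s ∈ S, X s • a s = V *ᵥ ψ - Λ *ᵥ ψ + n := by
    have : V *ᵥ ψ - Λ *ᵥ ψ = ∑ s ∈ S, (a s ⬝ᵥ ψ) • a s := by
      rw [hVdef, gram, add_mulVec, add_sub_cancel_left, sum_mulVec]
      refine Finset.sum_congr rfl fun s _ => ?_
      rw [vecMulVec_mulVec]
      ext i
      simp [mul_comm]
    rw [this, hn, ← Finset.sum_add_distrib]
    refine Finset.sum_congr rfl fun s hs => ?_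
    rw [hX s hs, add_smul]
  have hest : z ⬝ᵥ estimate Λ S a X - z ⬝ᵥ ψ = z ⬝ᵥ V⁻¹ *ᵥ n - z ⬝ᵥ V⁻¹ *ᵥ (Λ *ᵥ ψ) := by
    rw [estimate, ← hVdef, hsum, mulVec_add, mulVec_sub, mulVec_mulVec, nonsing_inv_mul _ hVu,
      one_mulVec, dotProduct_add, dotProduct_sub]
    ring
  have hw := inv_quadForm_nonneg hV z
  set w := z ⬝ᵥ V⁻¹ *ᵥ z with hwdef
  have h1 : |z ⬝ᵥ V⁻¹ *ᵥ n| ≤ √w * √(2 * Real.log (((S.card : ℝ) + 1) ^ 2) +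
      Real.log (V.det / Λ.det)) := by
    rw [← Real.sqrt_mul hw]
    refine Real.abs_le_sqrt ((sq_dotProduct_mulVec_le hV.inv.posSemidef z n).trans ?_)
    exact mul_le_mul_of_nonneg_left hη hw
  have hsymm : z ⬝ᵥ V⁻¹ *ᵥ (Λ *ᵥ ψ) = (V⁻¹ *ᵥ z) ⬝ᵥ Λ *ᵥ ψ := by
    rw [dotProduct_mulVec, ← mulVec_transpose]
    congr 2
    simpa [IsHermitian] using hV.inv.1
  -- The bias accounts for the summand `1` of the radius: Cauchy–Schwarz in the norm of `Λ`,
  -- together with `Λ ≤ V` and `ψᵀ Λ ψ ≤ 1`.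
  have h2 : |z ⬝ᵥ V⁻¹ *ᵥ (Λ *ᵥ ψ)| ≤ √w := by
    refine Real.abs_le_sqrt ?_
    rw [hsymm]
    refine (sq_dotProduct_mulVec_le hΛ.posSemidef _ _).trans ?_
    have hle : (V⁻¹ *ᵥ z) ⬝ᵥ Λ *ᵥ (V⁻¹ *ᵥ z) ≤ w := by
      have hVV : (V⁻¹ *ᵥ z) ⬝ᵥ V *ᵥ (V⁻¹ *ᵥ z) = w := by
        rw [mulVec_mulVec, mul_nonsing_inv _ hVu, one_mulVec, dotProduct_comm]
      have hsplit : ∀ v, v ⬝ᵥ V *ᵥ v =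
          v ⬝ᵥ Λ *ᵥ v + v ⬝ᵥ (∑ s ∈ S, vecMulVec (a s) (a s)) *ᵥ v := fun v => by
        rw [hVdef, gram, add_mulVec, dotProduct_add]
      rw [← hVV, hsplit]
      refine le_add_of_nonneg_right ?_
      have hps : (∑ s ∈ S, vecMulVec (a s) (a s)).PosSemidef :=
        posSemidef_sum _ fun s _ => by simpa using posSemidef_vecMulVec_self_star (a s)
      simpa using hps.dotProduct_mulVec_nonneg (V⁻¹ *ᵥ z)
    have h0 : 0 ≤ (V⁻¹ *ᵥ z) ⬝ᵥ Λ *ᵥ (V⁻¹ *ᵥ z) := by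
      simpa using hΛ.posSemidef.dotProduct_mulVec_nonneg (V⁻¹ *ᵥ z)
    calc _ ≤ (V⁻¹ *ᵥ z) ⬝ᵥ Λ *ᵥ (V⁻¹ *ᵥ z) * 1 := mul_le_mul_of_nonneg_left hψ h0
      _ ≤ w := by linarith
  rw [hest, radius, ← hVdef]
  calc _ ≤ |z ⬝ᵥ V⁻¹ *ᵥ n| + |z ⬝ᵥ V⁻¹ *ᵥ (Λ *ᵥ ψ)| := abs_sub _ _
    _ ≤ _ := by linarith

/-- The regret of one round is at most twice the width of the confidence interval of the arm with
the largest upper confidence bound. -/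
lemma sub_le_two_mul_radius_mul {r : ℕ} {Λ : Matrix (Fin r) (Fin r) ℝ} (hΛ : Λ.PosDef)
    {S : Finset ℕ} {a : ℕ → Fin r → ℝ} {X η : ℕ → ℝ} {ψ : Fin r → ℝ}
    (hX : ∀ s ∈ S, X s = a s ⬝ᵥ ψ + η s) (hψ : ψ ⬝ᵥ Λ *ᵥ ψ ≤ 1)
    (hη : (∑ s ∈ S, η s • a s) ⬝ᵥ (gram Λ S a)⁻¹ *ᵥ (∑ s ∈ S, η s • a s) ≤
      2 * Real.log (((S.card : ℝ) + 1) ^ 2) + Real.log ((gram Λ S a).det / Λ.det))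
    {y z : Fin r → ℝ} (hyz : ucb Λ S a X y ≤ ucb Λ S a X z) :
    y ⬝ᵥ ψ - z ⬝ᵥ ψ ≤ 2 * (radius Λ S a * √(z ⬝ᵥ (gram Λ S a)⁻¹ *ᵥ z)) := by
  have h1 := abs_le.1 (abs_dotProduct_estimate_sub_le hΛ hX hψ hη y)
  have h2 := abs_le.1 (abs_dotProduct_estimate_sub_le hΛ hX hψ hη z)
  unfold ucb at hyz
  linarith [h1.1, h2.2]

/-- The regret of one LinUCB learner over the rounds in which its confidence ellipsoid is valid. -/
lemma sum_le_of_le_radius_mul {r : ℕ} (hr : 0 < r) {Λ : Matrix (Fin r) (Fin r) ℝ} (hΛ : Λ.PosDef)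
    (P : ℕ → Prop) [DecidablePred P] (a : ℕ → Fin r → ℝ) (H : ℕ)
    (hdet : ∀ S ⊆ (Finset.range H).filter P,
      (gram Λ S a).det / Λ.det ≤ ((r : ℝ) ^ 2 * (1 + S.card)) ^ r)
    {f : ℕ → ℝ} (hf : ∀ s ∈ (Finset.range H).filter P, f s ≤ 2)
    (hf' : ∀ s ∈ (Finset.range H).filter P, f s ≤ 2 * (radius Λ ((Finset.range s).filter P) a *
      √(a s ⬝ᵥ (gram Λ ((Finset.range s).filter P) a)⁻¹ *ᵥ a s))) :
    ∑ s ∈ (Finset.range H).filter P, f s ≤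
      12 * r * (√((Finset.range H).filter P).card *
        Real.log ((r : ℝ) ^ 2 * (1 + ((Finset.range H).filter P).card))) := by
  set F := (Finset.range H).filter P with hF
  rcases Finset.eq_empty_or_nonempty F with h0 | hne
  · simp [h0]
  have hk : (1 : ℝ) ≤ F.card := by exact_mod_cast hne.card_pos
  have hr1 : (1 : ℝ) ≤ r := by exact_mod_cast hr
  have hr2 : (1 : ℝ) ≤ (r : ℝ) ^ 2 := one_le_pow₀ hr1
  set L := Real.log ((r : ℝ) ^ 2 * (1 + F.card)) with hL
  have hLhalf : 1 / 2 ≤ L := by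
    have h2 := Real.log_two_gt_d9
    have : Real.log 2 ≤ L := Real.log_le_log (by norm_num) (by nlinarith)
    linarith
  have hlog : ∀ S ⊆ F, Real.log ((gram Λ S a).det / Λ.det) ≤ r * L := by
    intro S hS
    have hpos := div_pos (gram_posDef hΛ S a).det_pos hΛ.det_pos
    have hc : (S.card : ℝ) ≤ F.card := by exact_mod_cast Finset.card_le_card hS
    calc _ ≤ Real.log (((r : ℝ) ^ 2 * (1 + S.card)) ^ r) := Real.log_le_log hpos (hdet S hS)
      _ = r * Real.log ((r : ℝ) ^ 2 * (1 + S.card)) := Real.log_pow _ _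
      _ ≤ r * L := by
        gcongr
        exact Real.log_le_log (by positivity) (by gcongr)
  set x := (r : ℝ) * L with hx
  have hxhalf : 1 / 2 ≤ x := by nlinarith
  -- The terms under the root add up to at most `5 x`, and `√5 ≤ 5 / 2`; since `x ≥ 1 / 2`, the
  -- summand `1` is at most `3 / 2 * √x`.
  have hrad : ∀ s ∈ F, radius Λ ((Finset.range s).filter P) a ≤ 4 * √x := by
    intro s hs
    have hsub : (Finset.range s).filter P ⊆ F := by
      refine Finset.filter_subset_filter _ (Finset.range_subset_range.2 ?_)
      have := (Finset.mem_filter.1 hs).1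
      exact (Finset.mem_range.1 this).le
    have hc : (((Finset.range s).filter P).card : ℝ) ≤ F.card := by
      exact_mod_cast Finset.card_le_card hsub
    have h1 : Real.log ((((Finset.range s).filter P).card + 1 : ℝ) ^ 2) ≤ 2 * x := by
      rw [Real.log_pow]
      have : Real.log (((Finset.range s).filter P).card + 1 : ℝ) ≤ L :=
        Real.log_le_log (by positivity) (by nlinarith)
      have hLx : L ≤ x := by nlinarith
      push_cast
      linarith
    have h2 := hlog _ hsub
    rw [radius]
    have h3 : √(2 * Real.log ((((Finset.range s).filter P).card + 1 : ℝ) ^ 2) +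
        Real.log ((gram Λ ((Finset.range s).filter P) a).det / Λ.det)) ≤ 5 / 2 * √x := by
      rw [show (5 / 2 : ℝ) = √((5 / 2) ^ 2) by rw [Real.sqrt_sq (by norm_num)],
        ← Real.sqrt_mul (by positivity)]
      exact Real.sqrt_le_sqrt (by linarith)
    have h4 : 1 ≤ 3 / 2 * √x := by
      have : (2 / 3 : ℝ) ≤ √x := Real.le_sqrt_of_sq_le (by linarith)
      linarith
    linarith
  -- The cap `f s ≤ 2` allows the width to be truncated at `1`, as the elliptical potential lemma
  -- requires.
  have hterm : ∀ s ∈ F, f s ≤ 8 * √x *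
      √(min 1 (a s ⬝ᵥ (gram Λ ((Finset.range s).filter P) a)⁻¹ *ᵥ a s)) := by
    intro s hs
    have h1 := one_le_radius Λ ((Finset.range s).filter P) a
    have h2 := hrad s hs
    rcases min_choice 1 (a s ⬝ᵥ (gram Λ ((Finset.range s).filter P) a)⁻¹ *ᵥ a s) with h | h
    · rw [h, Real.sqrt_one]
      linarith [hf s hs]
    · rw [h]
      refine (hf' s hs).trans ?_
      have := mul_le_mul_of_nonneg_right h2 (Real.sqrt_nonneg
        (a s ⬝ᵥ (gram Λ ((Finset.range s).filter P) a)⁻¹ *ᵥ a s))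
      linarith
  have hnn : ∀ s, 0 ≤ min 1 (a s ⬝ᵥ (gram Λ ((Finset.range s).filter P) a)⁻¹ *ᵥ a s) :=
    fun s => le_min zero_le_one (inv_quadForm_nonneg (gram_posDef hΛ _ _) _)
  have hCS : ∑ s ∈ F, √(min 1 (a s ⬝ᵥ (gram Λ ((Finset.range s).filter P) a)⁻¹ *ᵥ a s)) ≤
      √(F.card * (2 * x)) := by
    refine Real.le_sqrt_of_sq_le ((sq_sum_le_card_mul_sum_sq).trans ?_)
    gcongr
    calc _ = ∑ s ∈ F, min 1 (a s ⬝ᵥ (gram Λ ((Finset.range s).filter P) a)⁻¹ *ᵥ a s) :=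
          Finset.sum_congr rfl fun s _ => Real.sq_sqrt (hnn s)
      _ ≤ _ := sum_min_one_le hΛ P a H
      _ ≤ 2 * x := by linarith [hlog F (Finset.Subset.refl _)]
  calc ∑ s ∈ F, f s ≤ 8 * √x * √(F.card * (2 * x)) := by
        refine (Finset.sum_le_sum hterm).trans ?_
        rw [← Finset.mul_sum]
        gcongr
    _ = 8 * √2 * x * √F.card := by
        rw [Real.sqrt_mul (Nat.cast_nonneg _) (2 * x), Real.sqrt_mul zero_le_two x]
        have : √x * √x = x := Real.mul_self_sqrt (by linarith)
        linear_combination (8 * √2 * √F.card) * this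
    _ ≤ 12 * x * √F.card := by
        have : √2 ≤ 3 / 2 := Real.sqrt_le_iff.2 ⟨by norm_num, by norm_num⟩
        gcongr
        linarith
    _ = _ := by rw [hx]; ring

/-! ### Distribution of the rounds among the users -/

lemma log_one_add_le_two_mul_sqrt {y : ℝ} (hy : 0 ≤ y) : Real.log (1 + y) ≤ 2 * √y := by
  have h0 := Real.sqrt_nonneg y
  calc Real.log (1 + y) ≤ Real.log ((1 + √y) ^ 2) := by
        refine Real.log_le_log (by linarith) ?_
        nlinarith [Real.sq_sqrt hy]
    _ = 2 * Real.log (1 + √y) := by rw [Real.log_pow]; norm_num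
    _ ≤ 2 * √y := by
        have := Real.log_le_sub_one_of_pos (show 0 < 1 + √y by linarith)
        linarith

/-- The sum over the users of `√k log (q (1 + k))` is largest, up to a constant, when the users are
served equally often. -/
lemma sum_sqrt_mul_log_le {ι : Type*} [Fintype ι] {q N : ℝ} (hq : 1 ≤ q) (hN : 0 < N)
    (k : ι → ℕ) (hk : ∑ u, (k u : ℝ) = Fintype.card ι * N) :
    ∑ u, √(k u) * Real.log (q * (1 + k u)) ≤
      Fintype.card ι * √N * (Real.log (q * (1 + N)) + 2) := by
  set L := Real.log (q * (1 + N)) with hL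
  have hL0 : 0 ≤ L := Real.log_nonneg (by nlinarith)
  -- With `y = k u / N`, the tangent bound `√y ≤ (1 + y) / 2` makes the estimate affine in `y`, and
  -- the `y` sum to the number of users.
  have hpt : ∀ u, √(k u) * Real.log (q * (1 + k u)) ≤
      √N * ((1 + k u / N) / 2 * L + 2 * (k u / N)) := by
    intro u
    set y : ℝ := k u / N with hy
    have hy0 : 0 ≤ y := by positivity
    have hky : (k u : ℝ) = N * y := by rw [hy]; field_simp
    have hlog : Real.log (q * (1 + k u)) ≤ L + 2 * √y := by
      calc Real.log (q * (1 + k u)) ≤ Real.log (q * (1 + N) * (1 + y)) := by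
            refine Real.log_le_log (by positivity) ?_
            rw [mul_assoc]
            gcongr
            rw [hky]
            nlinarith
        _ = L + Real.log (1 + y) := Real.log_mul (by positivity) (by positivity)
        _ ≤ _ := by linarith [log_one_add_le_two_mul_sqrt hy0]
    have hs := Real.sq_sqrt hy0
    calc √(k u) * Real.log (q * (1 + k u)) ≤ √(k u) * (L + 2 * √y) := by gcongr
      _ = √N * (√y * L + 2 * y) := by
        rw [hky, Real.sqrt_mul hN.le]
        linear_combination (2 * √N) * hs
      _ ≤ _ := by
        gcongr
        nlinarith [sq_nonneg (√y - 1)]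
  refine (Finset.sum_le_sum fun u _ => hpt u).trans ?_
  have hsum : ∑ u, (k u : ℝ) / N = Fintype.card ι := by
    rw [← Finset.sum_div, hk]; field_simp
  rw [← Finset.mul_sum, Finset.sum_add_distrib, ← Finset.sum_mul, ← Finset.sum_div,
    Finset.sum_add_distrib, ← Finset.mul_sum, hsum]
  simp only [Finset.sum_const, Finset.card_univ, nsmul_eq_mul, mul_one]
  apply le_of_eq
  ring

/-! ### The self-normalised bound -/

/-- The factor by which one observation multiplies the mixture supermartingale. -/
noncomputable def stepFactor (x α w : ℝ) : ℝ :=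
  Real.exp (((2 * x * α + x ^ 2 * w - α ^ 2) / (1 + w) - Real.log (1 + w)) / 2)

lemma measurable_stepFactor {Ω : Type*} [MeasurableSpace Ω] {x α w : Ω → ℝ} (hx : Measurable x)
    (hα : Measurable α) (hw : Measurable w) :
    Measurable fun ω => stepFactor (x ω) (α ω) (w ω) := by
  unfold stepFactor
  fun_prop

/-- Completing the square, as in Bayes' rule: the exponential weight with `λ = α + √w y`, times the
standard Gaussian prior of `y`, is a Gaussian density with normalising factor `stepFactor`. -/
lemma stepFactor_mul_gaussianPDFReal (x α y : ℝ) {w : ℝ} (hw : 0 ≤ w) :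
    stepFactor x α w *
        gaussianPDFReal (√w * (x - α) / (1 + w)) (1 / (1 + w)).toNNReal y =
      Real.exp (x * (α + √w * y) - (α + √w * y) ^ 2 / 2) * gaussianPDFReal 0 1 y := by
  have hw1 : 0 < 1 + w := by linarith
  have hs := Real.sq_sqrt hw
  have hv : (((1 / (1 + w)).toNNReal : ℝ≥0) : ℝ) = 1 / (1 + w) :=
    Real.coe_toNNReal _ (by positivity)
  have hpi := Real.pi_pos
  rw [gaussianPDFReal, gaussianPDFReal, hv, stepFactor, sub_div, Real.exp_sub]
  have hlog : Real.exp (Real.log (1 + w) / 2) = √(1 + w) := by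
    rw [Real.sqrt_eq_rpow, Real.rpow_def_of_pos hw1]
    congr 1; ring
  have hsq : √(2 * Real.pi * (1 / (1 + w))) = √(2 * Real.pi) / √(1 + w) := by
    rw [mul_one_div, Real.sqrt_div (by positivity)]
  rw [hlog, hsq]
  have e1 : Real.exp ((2 * x * α + x ^ 2 * w - α ^ 2) / (1 + w) / 2) *
      Real.exp (-(y - √w * (x - α) / (1 + w)) ^ 2 / (2 * (1 / (1 + w)))) =
      Real.exp (x * (α + √w * y) - (α + √w * y) ^ 2 / 2) * Real.exp (-(y - 0) ^ 2 / (2 * 1)) := by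
    rw [← Real.exp_add, ← Real.exp_add]
    congr 1
    field_simp
    generalize √w = t at hs ⊢
    subst hs
    ring
  have hsp : 0 < √(1 + w) := Real.sqrt_pos.2 hw1
  have hsp2 : 0 < √(2 * Real.pi) := Real.sqrt_pos.2 (by positivity)
  simp only [NNReal.coe_one, mul_one] at *
  calc _ = (√(2 * Real.pi))⁻¹ * (Real.exp ((2 * x * α + x ^ 2 * w - α ^ 2) / (1 + w) / 2) *
      Real.exp (-(y - √w * (x - α) / (1 + w)) ^ 2 / (2 * (1 / (1 + w))))) := by
        rw [inv_div]
        field_simp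
    _ = _ := by rw [e1]; ring

/-- The step factor is the average of `exp (x λ - λ² / 2)` over `λ` of mean `α` and variance `w`.
Subgaussianity, applied for each fixed `λ`, then bounds its expectation. -/
lemma ofReal_stepFactor (x α : ℝ) {w : ℝ} (hw : 0 ≤ w) :
    ENNReal.ofReal (stepFactor x α w) =
      ∫⁻ y, ENNReal.ofReal (Real.exp (x * (α + √w * y) - (α + √w * y) ^ 2 / 2) *
        gaussianPDFReal 0 1 y) := by
  have hw1 : 0 < 1 + w := by linarith
  simp_rw [← stepFactor_mul_gaussianPDFReal x α _ hw]
  simp_rw [ENNReal.ofReal_mul (show 0 ≤ stepFactor x α w from (Real.exp_pos _).le)]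
  rw [lintegral_const_mul _ (by fun_prop), lintegral_gaussianPDFReal_eq_one, mul_one]
  have : 0 < (1 / (1 + w)).toNNReal := Real.toNNReal_pos.2 (by positivity)
  exact this.ne'

lemma lintegral_exp_le {Ω : Type*} [MeasurableSpace Ω] {μ : Measure Ω} {η : Ω → ℝ} (hη : HasSubgaussianMGF η 1 μ) (t : ℝ) :
    ∫⁻ ω, ENNReal.ofReal (Real.exp (η ω * t - t ^ 2 / 2)) ∂μ ≤ 1 := by
  rw [← ofReal_integral_eq_lintegral_ofReal]
  · rw [← ENNReal.ofReal_one]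
    refine ENNReal.ofReal_le_ofReal ?_
    simp_rw [sub_eq_add_neg, Real.exp_add]
    rw [integral_mul_const]
    have h := hη.mgf_le t
    simp only [mgf, NNReal.coe_one, one_mul] at h
    simp_rw [mul_comm (η _) t]
    calc _ ≤ Real.exp (t ^ 2 / 2) * Real.exp (-(t ^ 2 / 2)) := by gcongr
      _ = 1 := by rw [← Real.exp_add]; simp
  · simp_rw [sub_eq_add_neg, Real.exp_add, mul_comm (η _) t]
    exact (hη.integrable_exp_mul t).mul_const _
  · exact Filter.Eventually.of_forall fun ω => (Real.exp_pos _).le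

lemma lintegral_stepFactor_le {Ω : Type*} [MeasurableSpace Ω] {μ : Measure Ω} [SFinite μ]
    {η : Ω → ℝ} (hm : Measurable η)
    (hη : HasSubgaussianMGF η 1 μ) (α : ℝ) {w : ℝ} (hw : 0 ≤ w) :
    ∫⁻ ω, ENNReal.ofReal (stepFactor (η ω) α w) ∂μ ≤ 1 := by
  simp_rw [ofReal_stepFactor _ α hw]
  rw [lintegral_lintegral_swap (by fun_prop)]
  calc _ = ∫⁻ y, (∫⁻ ω, ENNReal.ofReal (Real.exp (η ω * (α + √w * y) - (α + √w * y) ^ 2 / 2)) ∂μ) *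
        ENNReal.ofReal (gaussianPDFReal 0 1 y) := by
        refine lintegral_congr fun y => ?_
        rw [← lintegral_mul_const _ (by fun_prop)]
        refine lintegral_congr fun ω => ?_
        rw [ENNReal.ofReal_mul (Real.exp_pos _).le]
    _ ≤ ∫⁻ y, 1 * ENNReal.ofReal (gaussianPDFReal 0 1 y) := by
        refine lintegral_mono fun y => ?_
        gcongr
        exact lintegral_exp_le hη _
    _ = 1 := by
        simp_rw [one_mul]
        exact lintegral_gaussianPDFReal_eq_one _ one_ne_zero

/-- Independence makes the joint law of the past and the noise a product, so `Z`, `α` and `w` may be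
frozen while the noise is integrated. -/
lemma lintegral_mul_stepFactor_le {Ω : Type*} {m mΩ : MeasurableSpace Ω} {μ : Measure Ω}
    [IsProbabilityMeasure μ] (hmle : m ≤ mΩ)
    {η : Ω → ℝ} (hm : Measurable η) (hη : HasSubgaussianMGF η 1 μ)
    (hind : Indep (MeasurableSpace.comap η inferInstance) m μ)
    {Z α w : Ω → ℝ} (hZ : Measurable[m] Z) (hα : Measurable[m] α) (hw : Measurable[m] w)
    (hw0 : ∀ ω, 0 ≤ w ω) :
    ∫⁻ ω, ENNReal.ofReal (Z ω) * ENNReal.ofReal (stepFactor (η ω) (α ω) (w ω)) ∂μ ≤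
      ∫⁻ ω, ENNReal.ofReal (Z ω) ∂μ := by
  let Y : Ω → ℝ × ℝ × ℝ := fun ω => (Z ω, α ω, w ω)
  have hYm : Measurable[m] Y := hZ.prodMk (hα.prodMk hw)
  have hY : Measurable Y := hYm.mono hmle le_rfl
  have hindf : IndepFun Y η μ := by
    refine (Indep.symm ?_)
    exact indep_of_indep_of_le_right hind hYm.comap_le
  have hlaw := (indepFun_iff_map_prod_eq_prod_map_map hY.aemeasurable hm.aemeasurable).1 hindf
  let g : (ℝ × ℝ × ℝ) × ℝ → ℝ≥0∞ := fun p =>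
    ENNReal.ofReal p.1.1 * ENNReal.ofReal (stepFactor p.2 p.1.2.1 p.1.2.2)
  have hg : Measurable g := by
    have h1 : Measurable fun p : (ℝ × ℝ × ℝ) × ℝ => ENNReal.ofReal p.1.1 :=
      ENNReal.measurable_ofReal.comp (measurable_fst.comp measurable_fst)
    have h2 : Measurable fun p : (ℝ × ℝ × ℝ) × ℝ => stepFactor p.2 p.1.2.1 p.1.2.2 :=
      measurable_stepFactor measurable_snd
        (measurable_fst.comp (measurable_snd.comp measurable_fst))
        (measurable_snd.comp (measurable_snd.comp measurable_fst))
    exact h1.mul (ENNReal.measurable_ofReal.comp h2)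
  have := Measure.isProbabilityMeasure_map (μ := μ) hm.aemeasurable
  have := Measure.isProbabilityMeasure_map (μ := μ) hY.aemeasurable
  calc _ = ∫⁻ ω, g (Y ω, η ω) ∂μ := rfl
    _ = ∫⁻ p, g p ∂(μ.map fun ω => (Y ω, η ω)) := (lintegral_map hg (hY.prodMk hm)).symm
    _ = ∫⁻ y, ∫⁻ x, g (y, x) ∂(μ.map η) ∂(μ.map Y) := by
        rw [hlaw, lintegral_prod _ hg.aemeasurable]
    _ = ∫⁻ ω, ∫⁻ ω', g (Y ω, η ω') ∂μ ∂μ := by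
        rw [lintegral_map hg.lintegral_prod_right' hY]
        refine lintegral_congr fun ω => ?_
        exact lintegral_map (hg.comp measurable_prodMk_left) hm
    _ ≤ ∫⁻ ω, ENNReal.ofReal (Z ω) ∂μ := by
        refine lintegral_mono fun ω => ?_
        simp only [g, Y]
        rw [lintegral_const_mul _]
        · calc _ ≤ ENNReal.ofReal (Z ω) * 1 := by
                gcongr
                exact lintegral_stepFactor_le hm hη _ (hw0 ω)
            _ = _ := mul_one _
        · exact ENNReal.measurable_ofReal.comp
            (measurable_stepFactor hm measurable_const measurable_const)

/-- The mixture supermartingale `√(det Λ / det V) exp (‖∑ η b‖² / 2)`, the norm being that of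
`V⁻¹`. -/
noncomputable def mixture {r : ℕ} (Λ : Matrix (Fin r) (Fin r) ℝ) (b : ℕ → Fin r → ℝ) (η : ℕ → ℝ)
    (h : ℕ) : ℝ :=
  Real.exp (((∑ s ∈ Finset.range h, η s • b s) ⬝ᵥ
    (gram Λ (Finset.range h) b)⁻¹ *ᵥ (∑ s ∈ Finset.range h, η s • b s) -
      Real.log ((gram Λ (Finset.range h) b).det / Λ.det)) / 2)

lemma mixture_succ {r : ℕ} {Λ : Matrix (Fin r) (Fin r) ℝ} (hΛ : Λ.PosDef) (b : ℕ → Fin r → ℝ)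
    (η : ℕ → ℝ) (h : ℕ) :
    mixture Λ b η (h + 1) = mixture Λ b η h * stepFactor (η h)
      (b h ⬝ᵥ (gram Λ (Finset.range h) b)⁻¹ *ᵥ (∑ s ∈ Finset.range h, η s • b s))
      (b h ⬝ᵥ (gram Λ (Finset.range h) b)⁻¹ *ᵥ b h) := by
  rw [mixture, mixture, stepFactor, ← Real.exp_add, log_det_gram_div hΛ, log_det_gram_div hΛ,
    Finset.sum_range_succ, Finset.sum_range_succ, gram_range_succ,
    inv_quadForm_update (gram_posDef hΛ _ _)]
  congr 1
  ring

lemma mixture_pos {r : ℕ} (Λ : Matrix (Fin r) (Fin r) ℝ) (b : ℕ → Fin r → ℝ) (η : ℕ → ℝ)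
    (h : ℕ) : 0 < mixture Λ b η h :=
  Real.exp_pos _

/-! ### Measurability of matrix expressions -/

section Measurability

variable {Ω : Type*} {r : ℕ} {m : MeasurableSpace Ω}

lemma measurable_det {A : Ω → Matrix (Fin r) (Fin r) ℝ}
    (hA : ∀ i j, Measurable[m] fun ω => A ω i j) : Measurable[m] fun ω => (A ω).det := by
  simp_rw [det_apply]
  refine Finset.measurable_fun_sum _ fun σ _ => ?_
  exact (Finset.measurable_fun_prod _ fun i _ => hA _ _).const_smul _

lemma measurable_inv_apply {A : Ω → Matrix (Fin r) (Fin r) ℝ}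
    (hA : ∀ i j, Measurable[m] fun ω => A ω i j) (i j : Fin r) :
    Measurable[m] fun ω => (A ω)⁻¹ i j := by
  simp_rw [inv_def, Matrix.smul_apply, Ring.inverse_eq_inv', smul_eq_mul, adjugate_apply]
  refine (measurable_det hA).inv.mul (measurable_det fun k l => ?_)
  by_cases h : k = j
  · subst h; simp
  · simpa [updateRow_ne h] using hA k l

lemma measurable_mulVec_apply {k l : ℕ} {A : Ω → Matrix (Fin k) (Fin l) ℝ} {v : Ω → Fin l → ℝ}
    (hA : ∀ i j, Measurable[m] fun ω => A ω i j) (hv : ∀ i, Measurable[m] fun ω => v ω i)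
    (i : Fin k) : Measurable[m] fun ω => (A ω *ᵥ v ω) i := by
  simp_rw [mulVec, dotProduct]
  exact Finset.measurable_fun_sum _ fun j _ => (hA i j).mul (hv j)

lemma measurable_dotProduct {k : ℕ} {u v : Ω → Fin k → ℝ} (hu : ∀ i, Measurable[m] fun ω => u ω i)
    (hv : ∀ i, Measurable[m] fun ω => v ω i) : Measurable[m] fun ω => u ω ⬝ᵥ v ω :=
  Finset.measurable_fun_sum _ fun j _ => (hu j).mul (hv j)

lemma measurable_gram_apply (Λ : Matrix (Fin r) (Fin r) ℝ) {S : Finset ℕ}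
    {b : ℕ → Ω → Fin r → ℝ} (hb : ∀ s ∈ S, ∀ i, Measurable[m] fun ω => b s ω i) (i j : Fin r) :
    Measurable[m] fun ω => gram Λ S (fun s => b s ω) i j := by
  simp_rw [gram, Matrix.add_apply, Matrix.sum_apply, vecMulVec_apply]
  exact (Finset.measurable_fun_sum _ fun s hs => (hb s hs i).mul (hb s hs j)).const_add _

lemma measurable_sum_smul_apply {S : Finset ℕ} {b : ℕ → Ω → Fin r → ℝ} {η : ℕ → Ω → ℝ}
    (hb : ∀ s ∈ S, ∀ i, Measurable[m] fun ω => b s ω i) (hη : ∀ s ∈ S, Measurable[m] (η s))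
    (i : Fin r) : Measurable[m] fun ω => (∑ s ∈ S, η s ω • b s ω) i := by
  simp_rw [Finset.sum_apply, Pi.smul_apply, smul_eq_mul]
  exact Finset.measurable_fun_sum _ fun s hs => (hη s hs).mul (hb s hs i)

lemma measurable_mixture (Λ : Matrix (Fin r) (Fin r) ℝ) {b : ℕ → Ω → Fin r → ℝ}
    {η : ℕ → Ω → ℝ} {h : ℕ} (hb : ∀ s < h, ∀ i, Measurable[m] fun ω => b s ω i)
    (hη : ∀ s < h, Measurable[m] (η s)) :
    Measurable[m] fun ω => mixture Λ (fun s => b s ω) (fun s => η s ω) h := by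
  have hb' : ∀ s ∈ Finset.range h, ∀ i, Measurable[m] fun ω => b s ω i :=
    fun s hs => hb s (Finset.mem_range.1 hs)
  have hη' : ∀ s ∈ Finset.range h, Measurable[m] (η s) := fun s hs => hη s (Finset.mem_range.1 hs)
  have hG := measurable_gram_apply Λ hb'
  have hN := measurable_sum_smul_apply hb' hη'
  refine Real.measurable_exp.comp (Measurable.div_const (Measurable.sub ?_ ?_) _)
  · exact measurable_dotProduct hN (measurable_mulVec_apply (measurable_inv_apply hG) hN)
  · exact Real.measurable_log.comp ((measurable_det hG).div_const _)

end Measurability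

/-- The self-normalised supermartingale bound, for predictable features `b`. -/
lemma lintegral_mixture_le_one {Ω : Type*} {mΩ : MeasurableSpace Ω} {μ : Measure Ω}
    [IsProbabilityMeasure μ] {ℱ : Filtration ℕ mΩ} {r : ℕ}
    {Λ : Matrix (Fin r) (Fin r) ℝ} (hΛ : Λ.PosDef) {b : ℕ → Ω → Fin r → ℝ} {η : ℕ → Ω → ℝ}
    (hb : ∀ s i, Measurable[ℱ s] fun ω => b s ω i) (hη : ∀ s, Measurable[ℱ (s + 1)] (η s))
    (hind : ∀ s, Indep (MeasurableSpace.comap (η s) inferInstance) (ℱ s) μ)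
    (hsub : ∀ s, HasSubgaussianMGF (η s) 1 μ) (h : ℕ) :
    ∫⁻ ω, ENNReal.ofReal (mixture Λ (fun s => b s ω) (fun s => η s ω) h) ∂μ ≤ 1 := by
  induction h with
  | zero => simp [mixture, gram, hΛ.det_pos.ne']
  | succ h ih =>
    refine le_trans ?_ ih
    simp_rw [mixture_succ hΛ, ENNReal.ofReal_mul (mixture_pos Λ _ _ h).le]
    have hb' : ∀ s ∈ Finset.range h, ∀ i, Measurable[ℱ h] fun ω => b s ω i :=
      fun s hs i => (hb s i).mono (ℱ.mono (Finset.mem_range.1 hs).le) le_rfl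
    have hη' : ∀ s ∈ Finset.range h, Measurable[ℱ h] (η s) :=
      fun s hs => (hη s).mono (ℱ.mono (Finset.mem_range.1 hs)) le_rfl
    have hG := measurable_gram_apply Λ hb'
    have hN := measurable_sum_smul_apply hb' hη'
    refine lintegral_mul_stepFactor_le (ℱ.le h) ((hη h).mono (ℱ.le _) le_rfl) (hsub h) (hind h)
      ?_ ?_ ?_ ?_
    · exact measurable_mixture Λ (fun s hs => hb' s (Finset.mem_range.2 hs))
        fun s hs => hη' s (Finset.mem_range.2 hs)
    · exact measurable_dotProduct (hb h) (measurable_mulVec_apply (measurable_inv_apply hG) hN)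
    · exact measurable_dotProduct (hb h) (measurable_mulVec_apply (measurable_inv_apply hG) (hb h))
    · exact fun ω => inv_quadForm_nonneg (gram_posDef hΛ _ _) _

/-- The probability that the self-normalised noise is large. -/
lemma measure_le_mixture_le {Ω : Type*} {mΩ : MeasurableSpace Ω} {μ : Measure Ω}
    [IsProbabilityMeasure μ] {ℱ : Filtration ℕ mΩ} {r : ℕ}
    {Λ : Matrix (Fin r) (Fin r) ℝ} (hΛ : Λ.PosDef) {b : ℕ → Ω → Fin r → ℝ} {η : ℕ → Ω → ℝ}
    (hb : ∀ s i, Measurable[ℱ s] fun ω => b s ω i) (hη : ∀ s, Measurable[ℱ (s + 1)] (η s))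
    (hind : ∀ s, Indep (MeasurableSpace.comap (η s) inferInstance) (ℱ s) μ)
    (hsub : ∀ s, HasSubgaussianMGF (η s) 1 μ) (h : ℕ) {x : ℝ} (hx : 0 < x) :
    μ.real {ω | x ≤ mixture Λ (fun s => b s ω) (fun s => η s ω) h} ≤ x⁻¹ := by
  have hm : Measurable fun ω => mixture Λ (fun s => b s ω) (fun s => η s ω) h :=
    measurable_mixture Λ (fun s _ i => (hb s i).mono (ℱ.le _) le_rfl)
      fun s _ => (hη s).mono (ℱ.le _) le_rfl
  have h1 := meas_ge_le_lintegral_div (μ := μ) (ENNReal.measurable_ofReal.comp hm).aemeasurable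
    (ENNReal.ofReal_pos.2 hx).ne' ENNReal.ofReal_ne_top
  have h2 : μ {ω | x ≤ mixture Λ (fun s => b s ω) (fun s => η s ω) h} ≤ ENNReal.ofReal x⁻¹ := by
    calc _ ≤ μ {ω | ENNReal.ofReal x ≤
          (ENNReal.ofReal ∘ fun ω => mixture Λ (fun s => b s ω) (fun s => η s ω) h) ω} :=
          measure_mono fun ω hω => ENNReal.ofReal_le_ofReal hω
      _ ≤ _ := h1
      _ ≤ 1 / ENNReal.ofReal x := by
        gcongr
        exact lintegral_mixture_le_one hΛ hb hη hind hsub h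
      _ = _ := by rw [one_div, ENNReal.ofReal_inv_of_pos hx]
  exact ENNReal.toReal_le_of_le_ofReal (by positivity) h2

/-! ### Measurability and existence of the agent -/

section

variable {Ω : Type*} {m : MeasurableSpace Ω}

lemma measurable_apply_of_countable {ι E : Type*} [Countable ι] [MeasurableSpace ι]
    [MeasurableSingletonClass ι] [MeasurableSpace E] {J : Ω → ι} {g : ι → Ω → E}
    (hJ : Measurable J) (hg : ∀ i, Measurable (g i)) : Measurable fun ω => g (J ω) ω := by
  have : Measurable fun p : Ω × ι => g p.2 p.1 := measurable_from_prod_countable_left hg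
  exact this.comp (measurable_id.prodMk hJ)

lemma measurable_comp_of_forall {ι E : Type*} [MeasurableSpace E] {M : (ι → ℝ) → E}
    (hM : Measurable M) {f : Ω → ι → ℝ} (hf : ∀ i, Measurable fun ω => f ω i) :
    Measurable fun ω => M (f ω) :=
  hM.comp (measurable_pi_iff.2 hf)

lemma measurableSet_pastRounds_eq {U : ℕ} {user : ℕ → Ω → Fin U} {h : ℕ}
    (hu : ∀ s ≤ h, Measurable (user s)) (S : Finset ℕ) :
    MeasurableSet {ω | pastRounds user h ω = S} := by
  by_cases hS : S ⊆ Finset.range h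
  · have : {ω | pastRounds user h ω = S} =
        ⋂ s ∈ Finset.range h, {ω | user s ω = user h ω ↔ s ∈ S} := by
      ext ω
      simp only [Set.mem_ofPred_eq, Set.mem_iInter, Finset.ext_iff, pastRounds, Finset.mem_filter]
      exact ⟨fun H s hs => by simpa [hs] using H s, fun H s =>
        ⟨fun hs => (H s hs.1).1 hs.2, fun hs => ⟨hS hs, (H s (hS hs)).2 hs⟩⟩⟩
    rw [this]
    refine Finset.measurableSet_biInter _ fun s hs => ?_
    have : MeasurableSet {ω | user s ω = user h ω} :=
      measurableSet_eq_fun (hu s (Finset.mem_range.1 hs).le) (hu h le_rfl)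
    exact this.iff (MeasurableSet.const _)
  · convert MeasurableSet.empty
    rw [Set.eq_empty_iff_forall_notMem]
    rintro ω rfl
    exact hS (Finset.filter_subset _ _)

lemma measurable_pastRounds_apply {U : ℕ} {user : ℕ → Ω → Fin U} {h : ℕ}
    (hu : ∀ s ≤ h, Measurable (user s)) {E : Type*} [MeasurableSpace E] {g : Finset ℕ → Ω → E}
    (hg : ∀ S ⊆ Finset.range h, Measurable (g S)) :
    Measurable fun ω => g (pastRounds user h ω) ω := by
  let : MeasurableSpace (Finset ℕ) := ⊤
  have hJ : Measurable (pastRounds user h) :=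
    measurable_to_countable' fun S => measurableSet_pastRounds_eq hu S
  -- Intersecting with `Finset.range h` gives a family that is measurable for every index set, not
  -- only for subsets of the past.
  have : (fun ω => g (pastRounds user h ω) ω) =
      fun ω => g (pastRounds user h ω ∩ Finset.range h) ω := by
    ext ω
    have : pastRounds user h ω ⊆ Finset.range h := Finset.filter_subset _ _
    rw [Finset.inter_eq_left.2 this]
  rw [this]
  exact measurable_apply_of_countable (g := fun S => g (S ∩ Finset.range h)) hJ
    fun S => hg _ Finset.inter_subset_right

lemma measurable_ucb {r : ℕ} (Λ : Matrix (Fin r) (Fin r) ℝ) {S : Finset ℕ}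
    {a : ℕ → Ω → Fin r → ℝ} {X : ℕ → Ω → ℝ} {z : Ω → Fin r → ℝ}
    (ha : ∀ s ∈ S, ∀ i, Measurable fun ω => a s ω i) (hX : ∀ s ∈ S, Measurable (X s))
    (hz : ∀ i, Measurable fun ω => z ω i) :
    Measurable fun ω => ucb Λ S (fun s => a s ω) (fun s => X s ω) (z ω) := by
  have hG := measurable_gram_apply Λ ha
  have hGi := measurable_inv_apply hG
  refine Measurable.add ?_ (Measurable.mul ?_ ?_)
  · exact measurable_dotProduct hz (measurable_mulVec_apply hGi (measurable_sum_smul_apply ha hX))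
  · refine Measurable.const_add (Real.continuous_sqrt.measurable.comp (Measurable.const_add ?_ _)) _
    exact Real.measurable_log.comp ((measurable_det hG).div_const _)
  · exact Real.continuous_sqrt.measurable.comp
      (measurable_dotProduct hz (measurable_mulVec_apply hGi hz))

end

/-- Breaking ties by the smallest index makes the choice measurable. -/
lemma exists_measurable_argmax {K : ℕ} (hK : 0 < K) :
    ∃ M : (Fin K → ℝ) → Fin K, Measurable M ∧ ∀ (f : Fin K → ℝ) (i : Fin K), f i ≤ f (M f) := by
  classical
  have := Fin.pos_iff_nonempty.1 hK
  let p : (Fin K → ℝ) → ℕ → Prop := fun f k => ∃ hk : k < K, ∀ i, f i ≤ f ⟨k, hk⟩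
  have hp : ∀ f, ∃ k, p f k := fun f => by
    obtain ⟨j, hj⟩ := Finite.exists_max f
    exact ⟨j, j.2, hj⟩
  have hpm : ∀ k, MeasurableSet {f | p f k} := fun k => by
    by_cases hk : k < K
    · have : {f : Fin K → ℝ | p f k} = ⋂ i, {f | f i ≤ f ⟨k, hk⟩} := by
        ext f; simp [p, hk]
      rw [this]
      exact MeasurableSet.iInter fun i =>
        measurableSet_le (measurable_pi_apply i) (measurable_pi_apply _)
    · have : {f : Fin K → ℝ | p f k} = ∅ := by
        ext f; simp [p, hk]
      rw [this]
      exact MeasurableSet.empty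
  refine ⟨fun f => ⟨Nat.find (hp f), (Nat.find_spec (hp f)).1⟩, ?_, fun f i =>
    (Nat.find_spec (hp f)).2 i⟩
  refine measurable_to_countable' fun i => ?_
  have : (fun f => (⟨Nat.find (hp f), (Nat.find_spec (hp f)).1⟩ : Fin K)) ⁻¹' {i} =
      (fun f => Nat.find (hp f)) ⁻¹' {(i : ℕ)} := by
    ext f; simp [Fin.ext_iff]
  rw [this]
  exact measurable_find hp hpm (measurableSet_singleton _)

/-- `P n` is the table with the first `n` entries filled in. The default `d` occupies the rest and
does not matter, since `Φ h` depends only on entries below `h`. -/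
lemma exists_strong_recursion {α : Type*} (d : α) (Φ : ℕ → (ℕ → α) → α)
    (hΦ : ∀ h I J, (∀ s < h, I s = J s) → Φ h I = Φ h J) : ∃ I : ℕ → α, ∀ h, I h = Φ h I := by
  let P : ℕ → ℕ → α := fun n => Nat.rec (fun _ => d) (fun h J => Function.update J h (Φ h J)) n
  have hP : ∀ h, P (h + 1) = Function.update (P h) h (Φ h (P h)) := fun h => rfl
  have key : ∀ h, ∀ s < h, P h s = P (s + 1) s := by
    intro h
    induction h with
    | zero => simp
    | succ h ih =>
      intro s hs
      rcases Nat.lt_succ_iff_lt_or_eq.1 hs with hlt | rfl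
      · rw [hP, Function.update_of_ne hlt.ne, ih s hlt]
      · rfl
  refine ⟨fun h => P (h + 1) h, fun h => ?_⟩
  change P (h + 1) h = _
  rw [hP, Function.update_self]
  exact hΦ _ _ _ (key h)

section Bandit

variable {Ω : Type*} {mΩ : MeasurableSpace Ω} {μ : Measure Ω} {ℱ : Filtration ℕ mΩ}
  {n b r T U K : ℕ} {B : Fin T → Matrix (Fin b) (Fin n) ℝ}
  {𝒰 : Fin T → Matrix (Fin b) (Fin r) ℝ} {θ : Fin U → Fin n → ℝ} {φ : Fin U → Fin r → ℝ}
  {user : ℕ → Ω → Fin U} {task : ℕ → Ω → Fin T} {arm : ℕ → Ω → Fin K → Fin b → ℝ}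
  {η : ℕ → Ω → ℝ} {I : ℕ → Ω → Fin K}

lemma IsInstance.measurable_feature (hinst : IsInstance μ ℱ B 𝒰 θ φ user task arm η) (h : ℕ)
    (i : Fin K) (j : Fin r) : Measurable[ℱ h] fun ω => feature 𝒰 task arm h ω i j :=
  measurable_apply_of_countable (m := ℱ h) (g := fun t ω => ((𝒰 t)ᵀ *ᵥ arm h ω i) j)
    (hinst.measurable_task h) fun t =>
      measurable_mulVec_apply (m := ℱ h) (A := fun _ => (𝒰 t)ᵀ) (v := fun ω => arm h ω i)
        (fun _ _ => measurable_const)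
        (fun k => (measurable_pi_apply k).comp (hinst.measurable_arm h i)) j

lemma IsInstance.measurable_feature_choice (hinst : IsInstance μ ℱ B 𝒰 θ φ user task arm η)
    {h : ℕ} {J : Ω → Fin K} (hJ : Measurable[ℱ h] J) (j : Fin r) :
    Measurable[ℱ h] fun ω => feature 𝒰 task arm h ω (J ω) j :=
  measurable_apply_of_countable (m := ℱ h) (g := fun i ω => feature 𝒰 task arm h ω i j) hJ
    fun i => hinst.measurable_feature h i j

lemma IsInstance.measurable_meanReward (hinst : IsInstance μ ℱ B 𝒰 θ φ user task arm η) (h : ℕ)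
    (i : Fin K) : Measurable[ℱ h] fun ω => meanReward B θ (user h ω) (task h ω) (arm h ω i) :=
  measurable_apply_of_countable (m := ℱ h)
    (g := fun t ω => meanReward B θ (user h ω) t (arm h ω i)) (hinst.measurable_task h) fun t =>
    measurable_apply_of_countable (m := ℱ h)
      (g := fun u ω => meanReward B θ u t (arm h ω i)) (hinst.measurable_user h) fun _ =>
      measurable_dotProduct (fun k => (measurable_pi_apply k).comp (hinst.measurable_arm h i))
        fun _ => measurable_const

lemma IsInstance.measurable_meanReward_choice (hinst : IsInstance μ ℱ B 𝒰 θ φ user task arm η)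
    {h : ℕ} {J : Ω → Fin K} (hJ : Measurable[ℱ h] J) :
    Measurable[ℱ h] fun ω => meanReward B θ (user h ω) (task h ω) (arm h ω (J ω)) :=
  measurable_apply_of_countable (m := ℱ h)
    (g := fun i ω => meanReward B θ (user h ω) (task h ω) (arm h ω i)) hJ
    fun i => hinst.measurable_meanReward h i

lemma IsInstance.measurable_reward (hinst : IsInstance μ ℱ B 𝒰 θ φ user task arm η)
    {h : ℕ} (hI : Measurable[ℱ h] (I h)) :
    Measurable[ℱ (h + 1)] (reward B θ user task arm η I h) :=
  ((hinst.measurable_meanReward_choice hI).mono (ℱ.mono h.le_succ) le_rfl).add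
    (hinst.measurable_noise h)

lemma IsInstance.exists_isPerUserLinUCB (hinst : IsInstance μ ℱ B 𝒰 θ φ user task arm η)
    (hK : 0 < K) (Λ : Matrix (Fin r) (Fin r) ℝ) :
    ∃ I : ℕ → Ω → Fin K, IsPerUserLinUCB ℱ Λ B 𝒰 θ user task arm η I := by
  obtain ⟨M, hM, hMmax⟩ := exists_measurable_argmax hK
  let score : ℕ → (ℕ → Ω → Fin K) → Ω → Fin K → ℝ := fun h J ω i =>
    ucb Λ (pastRounds user h ω) (fun s => feature 𝒰 task arm s ω (J s ω))
      (fun s => reward B θ user task arm η J s ω) (feature 𝒰 task arm h ω i)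
  have hscore : ∀ h I J, (∀ s < h, I s = J s) → score h I = score h J := by
    intro h I J hIJ
    ext ω i
    have h1 : ∀ s ∈ pastRounds user h ω, I s = J s := fun s hs =>
      hIJ s (Finset.mem_range.1 (Finset.mem_filter.1 hs).1)
    have hg : gram Λ (pastRounds user h ω) (fun s => feature 𝒰 task arm s ω (I s ω)) =
        gram Λ (pastRounds user h ω) (fun s => feature 𝒰 task arm s ω (J s ω)) := by
      rw [gram, gram]
      congr 1
      exact Finset.sum_congr rfl fun s hs => by rw [h1 s hs]
    have hsum : ∑ s ∈ pastRounds user h ω,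
          reward B θ user task arm η I s ω • feature 𝒰 task arm s ω (I s ω) =
        ∑ s ∈ pastRounds user h ω,
          reward B θ user task arm η J s ω • feature 𝒰 task arm s ω (J s ω) :=
      Finset.sum_congr rfl fun s hs => by simp only [reward, h1 s hs]
    simp only [score, ucb, estimate, radius, hg, hsum]
  obtain ⟨I, hI⟩ := exists_strong_recursion (fun _ => ⟨0, hK⟩)
    (fun h J ω => M (score h J ω)) fun h I J hIJ => by simp only [hscore h I J hIJ]
  refine ⟨I, fun h => ?_, fun h ω i => ?_⟩
  · induction h using Nat.strong_induction_on with
    | _ h ih =>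
      rw [hI h]
      refine measurable_comp_of_forall (m := ℱ h) hM fun i => ?_
      refine measurable_pastRounds_apply (m := ℱ h) (g := fun S ω =>
        ucb Λ S (fun s => feature 𝒰 task arm s ω (I s ω))
          (fun s => reward B θ user task arm η I s ω) (feature 𝒰 task arm h ω i))
        (fun s hs => (hinst.measurable_user s).mono (ℱ.mono hs) le_rfl) fun S hS => ?_
      refine measurable_ucb (m := ℱ h) Λ (a := fun s ω => feature 𝒰 task arm s ω (I s ω))
        (X := fun s ω => reward B θ user task arm η I s ω)
        (fun s hs j => ?_) (fun s hs => ?_) fun j => hinst.measurable_feature h i j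
      · have hlt := Finset.mem_range.1 (hS hs)
        exact (hinst.measurable_feature_choice (ih s hlt) j).mono (ℱ.mono hlt.le) le_rfl
      · have hlt := Finset.mem_range.1 (hS hs)
        exact (hinst.measurable_reward (ih s hlt)).mono (ℱ.mono hlt) le_rfl
  · have := hMmax (score h I ω) i
    have h2 : M (score h I ω) = I h ω := (congrFun (hI h) ω).symm
    rw [h2] at this
    exact this

end Bandit

/-! ### The regret bound -/

/-- From `1 + t E X ≤ E exp (t X) ≤ exp (t² / 2) ≤ 1 + t²`, with small `t` of either sign. -/
lemma integral_eq_zero_of_hasSubgaussianMGF {Ω : Type*} [MeasurableSpace Ω] {μ : Measure Ω}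
    [IsProbabilityMeasure μ] {X : Ω → ℝ} (hX : HasSubgaussianMGF X 1 μ) : ∫ ω, X ω ∂μ = 0 := by
  have key : ∀ t : ℝ, |t| ≤ 1 → t * ∫ ω, X ω ∂μ ≤ t ^ 2 := by
    intro t ht
    have ht2 : t ^ 2 ≤ 1 := (sq_le_one_iff_abs_le_one t).2 ht
    have h1 : 1 + t * ∫ ω, X ω ∂μ ≤ mgf X μ t := by
      have : ∫ ω, (1 + t * X ω) ∂μ = 1 + t * ∫ ω, X ω ∂μ := by
        rw [integral_add (integrable_const _) (hX.integrable.const_mul t), integral_const_mul]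
        simp
      rw [← this]
      refine integral_mono ((integrable_const _).add (hX.integrable.const_mul t))
        (hX.integrable_exp_mul t) fun ω => ?_
      have := Real.add_one_le_exp (t * X ω)
      linarith
    have h2 := hX.mgf_le t
    rw [NNReal.coe_one, one_mul] at h2
    have h3 := Real.exp_bound_div_one_sub_of_interval (x := t ^ 2 / 2) (by positivity)
      (by linarith)
    have h4 : 1 / (1 - t ^ 2 / 2) ≤ 1 + t ^ 2 := by
      rw [div_le_iff₀ (by linarith)]
      nlinarith [sq_nonneg t]
    linarith
  refine le_antisymm (le_of_forall_pos_le_add fun ε hε => ?_)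
    (le_of_forall_pos_le_add fun ε hε => ?_)
  · have h := key (min ε 1) (by rw [abs_of_pos (by positivity)]; exact min_le_right _ _)
    have hpos : 0 < min ε 1 := by positivity
    have : ∫ ω, X ω ∂μ ≤ min ε 1 := by nlinarith
    linarith [min_le_left ε 1]
  · have h := key (-min ε 1) (by rw [abs_neg, abs_of_pos (by positivity)]; exact min_le_right _ _)
    have hpos : 0 < min ε 1 := by positivity
    have : -∫ ω, X ω ∂μ ≤ min ε 1 := by nlinarith
    linarith [min_le_left ε 1]

lemma abs_dotProduct_le_one {b : ℕ} {x v : Fin b → ℝ} (hx : ‖WithLp.toLp 2 x‖ ≤ 1)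
    (hv : ‖WithLp.toLp 2 v‖ ≤ 1) : |x ⬝ᵥ v| ≤ 1 := by
  have h := abs_real_inner_le_norm (WithLp.toLp 2 v) (WithLp.toLp 2 x)
  rw [EuclideanSpace.inner_toLp_toLp, star_trivial] at h
  exact h.trans (mul_le_one₀ hv (norm_nonneg _) hx)

/-- The features `(U_t)ᵀ x` of the arms `x` of norm at most `1`. -/
def featureSet {b r T : ℕ} (𝒰 : Fin T → Matrix (Fin b) (Fin r) ℝ) : Set (Fin r → ℝ) :=
  ⋃ t, (fun x : EuclideanSpace ℝ (Fin b) => (𝒰 t)ᵀ *ᵥ x.ofLp) '' Metric.closedBall 0 1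

lemma isCompact_featureSet {b r T : ℕ} (𝒰 : Fin T → Matrix (Fin b) (Fin r) ℝ) :
    IsCompact (featureSet 𝒰) := by
  refine isCompact_iUnion fun t => (isCompact_closedBall _ _).image ?_
  exact Continuous.matrix_mulVec continuous_const (PiLp.continuous_ofLp 2 _)

lemma sum_inv_sq_le (H : ℕ) : ∑ k ∈ Finset.range H, (((k : ℝ) + 1) ^ 2)⁻¹ ≤ 2 - (H : ℝ)⁻¹ := by
  induction H with
  | zero => simp
  | succ H ih =>
    rw [Finset.sum_range_succ]
    -- The telescoping bound fails at `H = 0`, where `H⁻¹` is `0` by convention.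
    rcases Nat.eq_zero_or_pos H with rfl | hH
    · norm_num
    · have hH' : (0 : ℝ) < H := by exact_mod_cast hH
      have : (((H : ℝ) + 1) ^ 2)⁻¹ ≤ (H : ℝ)⁻¹ - ((H : ℝ) + 1)⁻¹ := by
        rw [inv_sub_inv hH'.ne' (by positivity), inv_eq_one_div]
        exact div_le_div₀ (by linarith) (by linarith) (by positivity) (by nlinarith)
      push_cast
      linarith

section Bandit

variable {Ω : Type*} {mΩ : MeasurableSpace Ω} {μ : Measure Ω} {ℱ : Filtration ℕ mΩ}
  {n b r T U K : ℕ} {B : Fin T → Matrix (Fin b) (Fin n) ℝ}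
  {𝒰 : Fin T → Matrix (Fin b) (Fin r) ℝ} {θ : Fin U → Fin n → ℝ} {φ : Fin U → Fin r → ℝ}
  {user : ℕ → Ω → Fin U} {task : ℕ → Ω → Fin T} {arm : ℕ → Ω → Fin K → Fin b → ℝ}
  {η : ℕ → Ω → ℝ} {I : ℕ → Ω → Fin K} {Λ : Matrix (Fin r) (Fin r) ℝ}

/-- The expected regret of a single round, given the past. -/
noncomputable def gap (B : Fin T → Matrix (Fin b) (Fin n) ℝ) (θ : Fin U → Fin n → ℝ)
    (user : ℕ → Ω → Fin U) (task : ℕ → Ω → Fin T) (arm : ℕ → Ω → Fin K → Fin b → ℝ)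
    (I : ℕ → Ω → Fin K) (h : ℕ) (ω : Ω) : ℝ :=
  (⨆ i, meanReward B θ (user h ω) (task h ω) (arm h ω i)) -
    meanReward B θ (user h ω) (task h ω) (arm h ω (I h ω))

lemma pathRegret_eq (H : ℕ) : pathRegret B θ user task arm η I H = fun ω =>
    ∑ h ∈ Finset.range H, gap B θ user task arm I h ω - ∑ h ∈ Finset.range H, η h ω := by
  ext ω
  simp only [pathRegret, reward, gap, Finset.sum_add_distrib, Finset.sum_sub_distrib]
  ring

lemma IsInstance.abs_meanReward_le (hinst : IsInstance μ ℱ B 𝒰 θ φ user task arm η) (h : ℕ)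
    (ω : Ω) (u : Fin U) (t : Fin T) (i : Fin K) : |meanReward B θ u t (arm h ω i)| ≤ 1 :=
  abs_dotProduct_le_one (hinst.norm_arm_le h ω i) (hinst.norm_param_le t u)

lemma gap_le_of_forall_le {h : ℕ} {ω : Ω} {D : ℝ}
    (hD : ∀ i, meanReward B θ (user h ω) (task h ω) (arm h ω i) -
      meanReward B θ (user h ω) (task h ω) (arm h ω (I h ω)) ≤ D) :
    gap B θ user task arm I h ω ≤ D := by
  have : Nonempty (Fin K) := ⟨I h ω⟩
  have := ciSup_le fun i => sub_le_iff_le_add.1 (hD i)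
  rw [gap]
  linarith

lemma IsInstance.gap_le_two (hinst : IsInstance μ ℱ B 𝒰 θ φ user task arm η) (h : ℕ) (ω : Ω) :
    gap B θ user task arm I h ω ≤ 2 :=
  gap_le_of_forall_le fun i => by
    have h1 := abs_le.1 (hinst.abs_meanReward_le h ω (user h ω) (task h ω) i)
    have h2 := abs_le.1 (hinst.abs_meanReward_le h ω (user h ω) (task h ω) (I h ω))
    linarith [h1.2, h2.1]

lemma gap_nonneg (h : ℕ) (ω : Ω) : 0 ≤ gap B θ user task arm I h ω :=
  sub_nonneg.2 (le_ciSup (f := fun i => meanReward B θ (user h ω) (task h ω) (arm h ω i))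
    (Set.finite_range _).bddAbove (I h ω))

lemma IsInstance.integrable_gap [IsProbabilityMeasure μ]
    (hinst : IsInstance μ ℱ B 𝒰 θ φ user task arm η) (hI : ∀ h, Measurable[ℱ h] (I h)) (h : ℕ) :
    Integrable (gap B θ user task arm I h) μ := by
  have hm : Measurable (gap B θ user task arm I h) :=
    (Measurable.iSup fun i => (hinst.measurable_meanReward h i).mono (ℱ.le h) le_rfl).sub
      ((hinst.measurable_meanReward_choice (hI h)).mono (ℱ.le h) le_rfl)
  refine Integrable.of_bound hm.aestronglyMeasurable 2 (Filter.Eventually.of_forall fun ω => ?_)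
  rw [Real.norm_eq_abs, abs_of_nonneg (gap_nonneg h ω)]
  exact hinst.gap_le_two h ω

lemma IsInstance.integrable_pathRegret [IsProbabilityMeasure μ]
    (hinst : IsInstance μ ℱ B 𝒰 θ φ user task arm η) (hI : ∀ h, Measurable[ℱ h] (I h)) (H : ℕ) :
    Integrable (pathRegret B θ user task arm η I H) μ := by
  rw [pathRegret_eq]
  exact (integrable_finsetSum _ fun h _ => hinst.integrable_gap hI h).sub
    (integrable_finsetSum _ fun h _ => (hinst.subgaussian_noise h).integrable)

lemma IsInstance.integral_pathRegret [IsProbabilityMeasure μ]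
    (hinst : IsInstance μ ℱ B 𝒰 θ φ user task arm η) (hI : ∀ h, Measurable[ℱ h] (I h)) (H : ℕ) :
    ∫ ω, pathRegret B θ user task arm η I H ω ∂μ =
      ∫ ω, ∑ h ∈ Finset.range H, gap B θ user task arm I h ω ∂μ := by
  rw [pathRegret_eq, integral_sub (integrable_finsetSum _ fun h _ => hinst.integrable_gap hI h)
    (integrable_finsetSum _ fun h _ => (hinst.subgaussian_noise h).integrable),
    integral_finsetSum (f := η) _ fun h _ => (hinst.subgaussian_noise h).integrable]
  simp [fun h => integral_eq_zero_of_hasSubgaussianMGF (hinst.subgaussian_noise h)]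

lemma IsInstance.integral_pathRegret_le_two_mul [IsProbabilityMeasure μ]
    (hinst : IsInstance μ ℱ B 𝒰 θ φ user task arm η) (hI : ∀ h, Measurable[ℱ h] (I h)) (H : ℕ) :
    ∫ ω, pathRegret B θ user task arm η I H ω ∂μ ≤ 2 * H := by
  rw [hinst.integral_pathRegret hI]
  calc _ ≤ ∫ _, ∑ _h ∈ Finset.range H, (2 : ℝ) ∂μ :=
        integral_mono (integrable_finsetSum _ fun h _ => hinst.integrable_gap hI h)
          (integrable_const _) fun ω => Finset.sum_le_sum fun h _ => hinst.gap_le_two h ω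
    _ = 2 * H := by simp [mul_comm]

lemma IsInstance.feature_mem (hinst : IsInstance μ ℱ B 𝒰 θ φ user task arm η) (h : ℕ) (ω : Ω)
    (i : Fin K) : feature 𝒰 task arm h ω i ∈ featureSet 𝒰 :=
  Set.mem_iUnion.2 ⟨task h ω, WithLp.toLp 2 (arm h ω i),
    by simpa using hinst.norm_arm_le h ω i, rfl⟩

lemma IsInstance.meanReward_eq (hinst : IsInstance μ ℱ B 𝒰 θ φ user task arm η) (h : ℕ) (ω : Ω)
    (u : Fin U) (i : Fin K) :
    meanReward B θ u (task h ω) (arm h ω i) = feature 𝒰 task arm h ω i ⬝ᵥ φ u := by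
  rw [meanReward, hinst.low_rank, feature, mulVec_transpose, ← dotProduct_mulVec]

/-- Pairings with features are mean rewards. This is the only control on `φ`, and the hypothesis
under which `exists_regularizer` supplies `ψ`. -/
lemma IsInstance.abs_dotProduct_le (hinst : IsInstance μ ℱ B 𝒰 θ φ user task arm η) (u : Fin U)
    {a : Fin r → ℝ} (ha : a ∈ featureSet 𝒰) : |a ⬝ᵥ φ u| ≤ 1 := by
  obtain ⟨t, x, hx, rfl⟩ := Set.mem_iUnion.1 ha
  simp only
  rw [mulVec_transpose, ← dotProduct_mulVec, ← hinst.low_rank]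
  exact abs_dotProduct_le_one (by simpa using hx) (hinst.norm_param_le t u)

/-! ### Truncation and failure of the confidence ellipsoids -/

/-- The features of the first `k` rounds of user `u`, the features of the other rounds being
replaced by `0`. -/
noncomputable def truncatedFeature (𝒰 : Fin T → Matrix (Fin b) (Fin r) ℝ) (user : ℕ → Ω → Fin U)
    (task : ℕ → Ω → Fin T) (arm : ℕ → Ω → Fin K → Fin b → ℝ) (I : ℕ → Ω → Fin K) (u : Fin U)
    (k s : ℕ) (ω : Ω) : Fin r → ℝ :=
  if user s ω = u ∧ ((Finset.range s).filter fun s' => user s' ω = u).card < k then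
    feature 𝒰 task arm s ω (I s ω) else 0

/-- Whether round `s` is among the first `k` of user `u` is known at time `s`, so truncation
preserves predictability. -/
lemma IsInstance.measurable_truncatedFeature (hinst : IsInstance μ ℱ B 𝒰 θ φ user task arm η)
    (hI : ∀ h, Measurable[ℱ h] (I h)) (u : Fin U) (k s : ℕ) (i : Fin r) :
    Measurable[ℱ s] fun ω => truncatedFeature 𝒰 user task arm I u k s ω i := by
  have huser : ∀ s' ≤ s, MeasurableSet[ℱ s] {ω | user s' ω = u} := fun s' hs' =>
    ℱ.mono hs' _ (hinst.measurable_user s' (measurableSet_singleton u))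
  have hcard : Measurable[ℱ s] fun ω =>
      ((Finset.range s).filter fun s' => user s' ω = u).card := by
    simp_rw [Finset.card_filter]
    exact Finset.measurable_fun_sum _ fun s' hs' => Measurable.ite
      (huser s' (Finset.mem_range.1 hs').le) measurable_const measurable_const
  have hset : MeasurableSet[ℱ s] {ω | user s ω = u ∧
      ((Finset.range s).filter fun s' => user s' ω = u).card < k} :=
    (huser s le_rfl).inter (hcard (measurableSet_Iio (a := k)))
  have : (fun ω => truncatedFeature 𝒰 user task arm I u k s ω i) = fun ω =>
      if user s ω = u ∧ ((Finset.range s).filter fun s' => user s' ω = u).card < k then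
        feature 𝒰 task arm s ω (I s ω) i else 0 := by
    ext ω
    rw [truncatedFeature]
    split_ifs <;> rfl
  rw [this]
  exact Measurable.ite hset (hinst.measurable_feature_choice (hI s) i) measurable_const

/-- The event that the noise of the first `k` rounds of user `u` is large. -/
def badEvent (Λ : Matrix (Fin r) (Fin r) ℝ) (𝒰 : Fin T → Matrix (Fin b) (Fin r) ℝ)
    (user : ℕ → Ω → Fin U) (task : ℕ → Ω → Fin T) (arm : ℕ → Ω → Fin K → Fin b → ℝ)
    (η : ℕ → Ω → ℝ) (I : ℕ → Ω → Fin K) (H : ℕ) (u : Fin U) (k : ℕ) : Set Ω :=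
  {ω | ((k : ℝ) + 1) ^ 2 ≤
    mixture Λ (fun s => truncatedFeature 𝒰 user task arm I u k s ω) (fun s => η s ω) H}

lemma IsInstance.measurableSet_badEvent (hinst : IsInstance μ ℱ B 𝒰 θ φ user task arm η)
    (hI : ∀ h, Measurable[ℱ h] (I h)) (H : ℕ) (u : Fin U) (k : ℕ) :
    MeasurableSet (badEvent Λ 𝒰 user task arm η I H u k) :=
  measurableSet_le measurable_const (measurable_mixture Λ
    (fun s _ i => (hinst.measurable_truncatedFeature hI u k s i).mono (ℱ.le _) le_rfl)
    fun s _ => (hinst.measurable_noise s).mono (ℱ.le _) le_rfl)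

lemma IsInstance.measureReal_badEvent_le [IsProbabilityMeasure μ]
    (hinst : IsInstance μ ℱ B 𝒰 θ φ user task arm η) (hI : ∀ h, Measurable[ℱ h] (I h))
    (hΛ : Λ.PosDef) (H : ℕ) (u : Fin U) (k : ℕ) :
    μ.real (badEvent Λ 𝒰 user task arm η I H u k) ≤ (((k : ℝ) + 1) ^ 2)⁻¹ :=
  measure_le_mixture_le hΛ (hinst.measurable_truncatedFeature hI u k) hinst.measurable_noise
    hinst.indep_noise hinst.subgaussian_noise H (by positivity)

/-- Outside the bad event, the noise before a round is small in the self-normalised norm. -/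
lemma noise_le_of_notMem_badEvent {H h : ℕ} (hh : h < H) {ω : Ω} {u : Fin U} {S : Finset ℕ}
    (hSu : S = (Finset.range h).filter fun s => user s ω = u) {a : ℕ → Fin r → ℝ}
    (ha : a = fun s => feature 𝒰 task arm s ω (I s ω))
    (hgood : ω ∉ badEvent Λ 𝒰 user task arm η I H u S.card) :
    (∑ s ∈ S, η s ω • a s) ⬝ᵥ (gram Λ S a)⁻¹ *ᵥ (∑ s ∈ S, η s ω • a s) ≤
      2 * Real.log (((S.card : ℝ) + 1) ^ 2) + Real.log ((gram Λ S a).det / Λ.det) := by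
  -- The rounds of `u` before `h` are exactly its first `S.card` rounds. Truncation at `k = S.card`
  -- therefore makes the state at the fixed time `H` equal to the state before round `h`.
  let Q : ℕ → Prop := fun s =>
    user s ω = u ∧ ((Finset.range s).filter fun s' => user s' ω = u).card < S.card
  have hS : S = (Finset.range H).filter Q := by
    ext s
    simp only [Q, hSu, Finset.mem_filter, Finset.mem_range, ← Nat.count_eq_card_filter_range]
    constructor
    · rintro ⟨hs, hu⟩
      exact ⟨hs.trans hh, hu, Nat.count_strict_mono hu hs⟩
    · rintro ⟨-, hu, hlt⟩
      refine ⟨?_, hu⟩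
      by_contra hle
      exact absurd (Nat.count_monotone (fun s' => user s' ω = u) (not_lt.1 hle)) (not_le.2 hlt)
  have hgram : gram Λ S a = gram Λ (Finset.range H)
      fun s => truncatedFeature 𝒰 user task arm I u S.card s ω := by
    conv_lhs => rw [hS, gram_filter, ha]
    rfl
  have hsum : ∑ s ∈ S, η s ω • a s = ∑ s ∈ Finset.range H,
      η s ω • truncatedFeature 𝒰 user task arm I u S.card s ω := by
    conv_lhs => rw [hS, Finset.sum_filter, ha]
    refine Finset.sum_congr rfl fun s _ => ?_
    simp only [truncatedFeature, smul_ite, smul_zero]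
  simp only [badEvent, Set.mem_ofPred_eq, not_le] at hgood
  rw [mixture, ← Real.lt_log_iff_exp_lt (pow_pos (Nat.cast_add_one_pos _) 2), ← hgram, ← hsum] at hgood
  linarith

/-- The regret of the rounds of one user on a sample path. -/
lemma sum_gap_user_le (hinst : IsInstance μ ℱ B 𝒰 θ φ user task arm η)
    (hI : IsPerUserLinUCB ℱ Λ B 𝒰 θ user task arm η I) (hr : 0 < r) (hΛ : Λ.PosDef)
    (hpar : ∀ φ : Fin r → ℝ, (∀ a ∈ featureSet 𝒰, |a ⬝ᵥ φ| ≤ 1) →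
      ∃ ψ : Fin r → ℝ, (∀ a ∈ featureSet 𝒰, a ⬝ᵥ φ = a ⬝ᵥ ψ) ∧ ψ ⬝ᵥ Λ *ᵥ ψ ≤ 1)
    (hdet : ∀ (S : Finset ℕ) (a : ℕ → Fin r → ℝ), (∀ s ∈ S, a s ∈ featureSet 𝒰) →
      (gram Λ S a).det / Λ.det ≤ ((r : ℝ) ^ 2 * (1 + S.card)) ^ r)
    (H : ℕ) (ω : Ω) (u : Fin U) :
    ∑ h ∈ (Finset.range H).filter (fun s => user s ω = u), gap B θ user task arm I h ω ≤
      12 * r * (√((Finset.range H).filter fun s => user s ω = u).card *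
        Real.log ((r : ℝ) ^ 2 * (1 + ((Finset.range H).filter fun s => user s ω = u).card))) +
      ∑ k ∈ Finset.range H,
        2 * (badEvent Λ 𝒰 user task arm η I H u k).indicator (fun _ => (1 : ℝ)) ω := by
  classical
  obtain ⟨ψ, hψ, hψ1⟩ := hpar (φ u) fun a ha => hinst.abs_dotProduct_le u ha
  set a : ℕ → Fin r → ℝ := fun s => feature 𝒰 task arm s ω (I s ω) with ha
  set F := (Finset.range H).filter fun s => user s ω = u with hF
  let κ : ℕ → ℕ := fun h => ((Finset.range h).filter fun s => user s ω = u).card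
  let bad : ℕ → Prop := fun k => ω ∈ badEvent Λ 𝒰 user task arm η I H u k
  have hmean : ∀ h, user h ω = u → ∀ i, meanReward B θ (user h ω) (task h ω) (arm h ω i) =
      feature 𝒰 task arm h ω i ⬝ᵥ ψ := fun h hu i => by
    rw [hu, hinst.meanReward_eq, hψ _ (hinst.feature_mem h ω i)]
  -- Only the regret is zeroed in bad rounds; their features stay in the Gram matrices, as they do
  -- for the agent.
  have hgood : ∑ h ∈ F, (if bad (κ h) then 0 else gap B θ user task arm I h ω) ≤
      12 * r * (√F.card * Real.log ((r : ℝ) ^ 2 * (1 + F.card))) := by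
    refine sum_le_of_le_radius_mul hr hΛ (fun s => user s ω = u) a H
      (fun S _ => hdet S a fun s _ => hinst.feature_mem s ω _) (fun h _ => ?_) fun h hh => ?_
    · split_ifs
      · exact zero_le_two
      · exact hinst.gap_le_two h ω
    · split_ifs with hb
      · have := one_le_radius Λ ((Finset.range h).filter fun s => user s ω = u) a
        positivity
      · obtain ⟨hh, hu⟩ := Finset.mem_filter.1 hh
        have hnoise := noise_le_of_notMem_badEvent (Finset.mem_range.1 hh) rfl ha hb
        refine gap_le_of_forall_le fun i => ?_
        rw [hmean h hu, hmean h hu]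
        refine sub_le_two_mul_radius_mul hΛ (X := fun s => reward B θ user task arm η I s ω)
          (η := fun s => η s ω) (fun s hs => ?_) hψ1 hnoise ?_
        · rw [reward, hmean s (Finset.mem_filter.1 hs).2]
        · have := hI.maximizes h ω i
          simpa only [pastRounds, hu] using this
  have hbad : ∑ h ∈ F, (if bad (κ h) then gap B θ user task arm I h ω else 0) ≤
      ∑ k ∈ Finset.range H,
        2 * (badEvent Λ 𝒰 user task arm η I H u k).indicator (fun _ => (1 : ℝ)) ω := by
    -- Distinct rounds of `u` have distinct numbers of predecessors, so each bad event is charged at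
    -- most once.
    have hinj : Set.InjOn κ F := by
      intro s hs s' hs' hss
      have hs := (Finset.mem_filter.1 (Finset.mem_coe.1 hs)).2
      have hs' := (Finset.mem_filter.1 (Finset.mem_coe.1 hs')).2
      simp only [κ, ← Nat.count_eq_card_filter_range] at hss
      exact Nat.count_injective hs hs' hss
    have hsub : F.image κ ⊆ Finset.range H := by
      intro k hk
      obtain ⟨h, hh, rfl⟩ := Finset.mem_image.1 hk
      refine Finset.mem_range.2 (lt_of_le_of_lt (Finset.card_filter_le _ _) ?_)
      rw [Finset.card_range]
      exact Finset.mem_range.1 (Finset.mem_filter.1 hh).1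
    calc _ ≤ ∑ h ∈ F,
          2 * (badEvent Λ 𝒰 user task arm η I H u (κ h)).indicator (fun _ => (1 : ℝ)) ω := by
          refine Finset.sum_le_sum fun h _ => ?_
          split_ifs with hb
          · rw [Set.indicator_of_mem hb, mul_one]
            exact hinst.gap_le_two h ω
          · rw [Set.indicator_of_notMem hb, mul_zero]
      _ = ∑ k ∈ F.image κ,
          2 * (badEvent Λ 𝒰 user task arm η I H u k).indicator (fun _ => (1 : ℝ)) ω :=
          (Finset.sum_image (f := fun k =>
            2 * (badEvent Λ 𝒰 user task arm η I H u k).indicator (fun _ => (1 : ℝ)) ω) hinj).symm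
      _ ≤ _ := Finset.sum_le_sum_of_subset_of_nonneg hsub fun k _ _ =>
          mul_nonneg zero_le_two (Set.indicator_nonneg (fun _ _ => zero_le_one) _)
  calc ∑ h ∈ F, gap B θ user task arm I h ω =
      ∑ h ∈ F, (if bad (κ h) then 0 else gap B θ user task arm I h ω) +
        ∑ h ∈ F, (if bad (κ h) then gap B θ user task arm I h ω else 0) := by
        rw [← Finset.sum_add_distrib]
        refine Finset.sum_congr rfl fun h _ => ?_
        split_ifs <;> simp
    _ ≤ _ := add_le_add hgood hbad

/-- The regret bound before it is simplified, `N` being the average number of rounds per user. -/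
lemma integral_pathRegret_le [IsProbabilityMeasure μ]
    (hinst : IsInstance μ ℱ B 𝒰 θ φ user task arm η)
    (hI : IsPerUserLinUCB ℱ Λ B 𝒰 θ user task arm η I) (hr : 0 < r) (hΛ : Λ.PosDef)
    (hpar : ∀ φ : Fin r → ℝ, (∀ a ∈ featureSet 𝒰, |a ⬝ᵥ φ| ≤ 1) →
      ∃ ψ : Fin r → ℝ, (∀ a ∈ featureSet 𝒰, a ⬝ᵥ φ = a ⬝ᵥ ψ) ∧ ψ ⬝ᵥ Λ *ᵥ ψ ≤ 1)
    (hdet : ∀ (S : Finset ℕ) (a : ℕ → Fin r → ℝ), (∀ s ∈ S, a s ∈ featureSet 𝒰) →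
      (gram Λ S a).det / Λ.det ≤ ((r : ℝ) ^ 2 * (1 + S.card)) ^ r)
    (H : ℕ) {N : ℝ} (hN : 0 < N) (hUN : (H : ℝ) = U * N) :
    ∫ ω, pathRegret B θ user task arm η I H ω ∂μ ≤
      12 * r * (U * √N * (Real.log ((r : ℝ) ^ 2 * (1 + N)) + 2)) + 4 * U := by
  have hr1 : (1 : ℝ) ≤ (r : ℝ) ^ 2 := one_le_pow₀ (by exact_mod_cast hr)
  have hpath : ∀ ω, ∑ h ∈ Finset.range H, gap B θ user task arm I h ω ≤
      12 * r * (U * √N * (Real.log ((r : ℝ) ^ 2 * (1 + N)) + 2)) +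
      ∑ u, ∑ k ∈ Finset.range H,
        2 * (badEvent Λ 𝒰 user task arm η I H u k).indicator (fun _ => (1 : ℝ)) ω := by
    intro ω
    rw [← Finset.sum_fiberwise (Finset.range H) fun s => user s ω]
    refine (Finset.sum_le_sum fun u _ =>
      sum_gap_user_le hinst hI hr hΛ hpar hdet H ω u).trans ?_
    rw [Finset.sum_add_distrib, ← Finset.mul_sum]
    gcongr
    have hk : ∑ u, (((Finset.range H).filter fun s => user s ω = u).card : ℝ) =
        Fintype.card (Fin U) * N := by
      rw [Fintype.card_fin, ← hUN, ← Nat.cast_sum, ← Finset.card_eq_sum_card_fiberwise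
        (fun s _ => Finset.mem_coe.2 (Finset.mem_univ (user s ω))), Finset.card_range]
    have := sum_sqrt_mul_log_le hr1 hN _ hk
    rwa [Fintype.card_fin] at this
  have hint : ∀ u, ∀ k ∈ Finset.range H, Integrable (fun ω =>
      2 * (badEvent Λ 𝒰 user task arm η I H u k).indicator (fun _ => (1 : ℝ)) ω) μ :=
    fun u k _ => ((integrable_const 1).indicator
      (hinst.measurableSet_badEvent hI.measurable_choice H u k)).const_mul 2
  have hint' : ∀ u ∈ (Finset.univ : Finset (Fin U)), Integrable (fun ω => ∑ k ∈ Finset.range H,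
      2 * (badEvent Λ 𝒰 user task arm η I H u k).indicator (fun _ => (1 : ℝ)) ω) μ :=
    fun u _ => integrable_finsetSum _ (hint u)
  rw [hinst.integral_pathRegret hI.measurable_choice]
  refine (integral_mono (integrable_finsetSum _ fun h _ =>
    hinst.integrable_gap hI.measurable_choice h)
    ((integrable_const _).add (integrable_finsetSum _ hint')) hpath).trans ?_
  rw [integral_add' (integrable_const _) (integrable_finsetSum _ hint'), integral_finsetSum _ hint']
  simp only [integral_const, probReal_univ, one_smul]
  gcongr
  calc _ ≤ ∑ _u : Fin U, (4 : ℝ) := by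
        refine Finset.sum_le_sum fun u _ => ?_
        rw [integral_finsetSum _ (hint u)]
        calc _ ≤ ∑ k ∈ Finset.range H, 2 * (((k : ℝ) + 1) ^ 2)⁻¹ := by
              refine Finset.sum_le_sum fun k _ => ?_
              rw [integral_const_mul, integral_indicator_const _
                (hinst.measurableSet_badEvent hI.measurable_choice H u k), smul_eq_mul, mul_one]
              gcongr
              exact hinst.measureReal_badEvent_le hI.measurable_choice hΛ H u k
          _ ≤ 4 := by
              rw [← Finset.mul_sum]
              have h1 := sum_inv_sq_le H
              have h2 : (0 : ℝ) ≤ (H : ℝ)⁻¹ := by positivity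
              linarith
    _ = 4 * U := by simp [mul_comm]

end Bandit

/-! ### Removal of `log r` and conclusion -/

lemma final_bound {c N ρ V R : ℝ} (hc : 1 < c) (hN : c ≤ N) (hρ : 1 ≤ ρ) (hV : 0 ≤ V)
    (h₁ : R ≤ 2 * (V * N))
    (h₂ : R ≤ 12 * ρ * (V * √N * (Real.log (ρ ^ 2 * (1 + N)) + 2)) + 4 * V) :
    R ≤ (36 + 40 / Real.log c) * (ρ * (V * √N) * Real.log N) := by
  have hl : 0 < Real.log c := Real.log_pos hc
  have hN1 : 1 < N := hc.trans_le hN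
  have hlN : Real.log c ≤ Real.log N := Real.log_le_log (by linarith) hN
  have hsN : 1 ≤ √N := Real.one_le_sqrt.2 hN1.le
  -- This turns additive constants into multiples of `log N`; the constant to be absorbed is `40 =
  -- 12 * 3 + 4`.
  have hone : 1 ≤ Real.log N / Real.log c := (one_le_div hl).2 hlN
  set q := Real.log N / Real.log c with hq
  have hRHS : (36 + 40 / Real.log c) * (ρ * (V * √N) * Real.log N) =
      ρ * (V * √N) * (36 * Real.log N + 40 * q) := by
    rw [hq]; field_simp
  rw [hRHS]
  have hpos : 0 ≤ ρ * (V * √N) := by positivity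
  have hlN0 : 0 < Real.log N := hl.trans_le hlN
  rcases le_total ρ N with hρN | hρN
  · have hlog : Real.log (ρ ^ 2 * (1 + N)) ≤ 3 * Real.log N + 1 := by
      have h2 := Real.log_two_lt_d9
      calc Real.log (ρ ^ 2 * (1 + N)) ≤ Real.log (N ^ 2 * (2 * N)) := by
            refine Real.log_le_log (by positivity) ?_
            gcongr
            linarith
        _ = 3 * Real.log N + Real.log 2 := by
            rw [Real.log_mul (by positivity) (by positivity), Real.log_pow,
              Real.log_mul (by norm_num) (by positivity)]
            push_cast; ring
        _ ≤ _ := by linarith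
    have hV4 : V ≤ ρ * (V * √N) := by
      calc V = 1 * (V * 1) := by ring
        _ ≤ _ := by gcongr
    calc R ≤ ρ * (V * √N) * (12 * (3 * Real.log N + 1 + 2)) + 4 * (ρ * (V * √N)) := by
          refine h₂.trans ?_
          have : 12 * ρ * (V * √N * (Real.log (ρ ^ 2 * (1 + N)) + 2)) =
              ρ * (V * √N) * (12 * (Real.log (ρ ^ 2 * (1 + N)) + 2)) := by ring
          rw [this]
          gcongr
      _ = ρ * (V * √N) * (36 * Real.log N + 40) := by ring
      _ ≤ _ := by gcongr; linarith
  -- Here `√N ≤ N ≤ ρ`, so the trivial bound `2 V √N √N` is at most `2 ρ V √N`.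
  · have hss : √N * √N = N := Real.mul_self_sqrt (by linarith)
    have : √N ≤ ρ := by nlinarith
    calc R ≤ 2 * (V * (√N * √N)) := by rw [hss]; exact h₁
      _ = √N * (V * √N) * 2 := by ring
      _ ≤ ρ * (V * √N) * (36 * Real.log N + 40 * q) := by
          gcongr
          linarith

end SkylineBandit

open SkylineBandit in
theorem mainTheorem4 (c : ℝ) (hc : 1 < c) :
    ∃ C : ℝ, ∀ (n b r T : ℕ) (B : Fin T → Matrix (Fin b) (Fin n) ℝ),
      ((SkylineBandit.stack B).rank ≤ r →
        ∃ (𝒰 : Fin T → Matrix (Fin b) (Fin r) ℝ) (W : Matrix (Fin r) (Fin n) ℝ),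
          ∀ t, B t = 𝒰 t * W) ∧
      ∀ 𝒰 : Fin T → Matrix (Fin b) (Fin r) ℝ,
        ∃ Λ : Matrix (Fin r) (Fin r) ℝ, Λ.PosDef ∧
          ∀ (U K : ℕ) (_ : 0 < K) (θ : Fin U → Fin n → ℝ) (φ : Fin U → Fin r → ℝ)
            (Ω : Type*) [mΩ : MeasurableSpace Ω] (μ : Measure Ω) [IsProbabilityMeasure μ]
            (ℱ : Filtration ℕ mΩ) (user : ℕ → Ω → Fin U) (task : ℕ → Ω → Fin T)
            (arm : ℕ → Ω → Fin K → Fin b → ℝ) (η : ℕ → Ω → ℝ),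
            SkylineBandit.IsInstance μ ℱ B 𝒰 θ φ user task arm η →
              (∃ I : ℕ → Ω → Fin K,
                SkylineBandit.IsPerUserLinUCB ℱ Λ B 𝒰 θ user task arm η I) ∧
              ∀ I : ℕ → Ω → Fin K,
                SkylineBandit.IsPerUserLinUCB ℱ Λ B 𝒰 θ user task arm η I →
                  ∀ H : ℕ, c * U ≤ H →
                    Integrable (SkylineBandit.pathRegret B θ user task arm η I H) μ ∧
                    ∫ ω, SkylineBandit.pathRegret B θ user task arm η I H ω ∂μ ≤
                      C * (r * √(U * H) * Real.log (H / U)) := by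
  refine ⟨36 + 40 / Real.log c, fun n b r T B => ⟨exists_factor_of_rank_stack_le B, fun 𝒰 => ?_⟩⟩
  -- For `r = 0` every mean reward is an empty sum, so there is no regret and any `Λ` works.
  rcases Nat.eq_zero_or_pos r with rfl | hr
  · refine ⟨1, PosDef.one, ?_⟩
    intro U K hK θ φ Ω mΩ μ hμ ℱ user task arm η hinst
    refine ⟨hinst.exists_isPerUserLinUCB hK 1, fun I hI H hH =>
      ⟨hinst.integrable_pathRegret hI.measurable_choice H, ?_⟩⟩
    rw [hinst.integral_pathRegret hI.measurable_choice]
    have hgap : ∀ h ω, gap B θ user task arm I h ω ≤ 0 := fun h ω =>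
      gap_le_of_forall_le fun i => by simp [hinst.meanReward_eq]
    calc _ ≤ (0 : ℝ) := integral_nonpos fun ω => Finset.sum_nonpos fun h _ => hgap h ω
      _ = _ := by simp
  · obtain ⟨Λ, hΛ, hpar, hdet⟩ := exists_regularizer hr (isCompact_featureSet 𝒰)
    refine ⟨Λ, hΛ, ?_⟩
    intro U K hK θ φ Ω mΩ μ hμ ℱ user task arm η hinst
    refine ⟨hinst.exists_isPerUserLinUCB hK Λ, fun I hI H hH =>
      ⟨hinst.integrable_pathRegret hI.measurable_choice H, ?_⟩⟩
    -- A sample point provides a user, hence `U > 0` and division by `U` is legitimate.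
    obtain ⟨ω⟩ := nonempty_of_isProbabilityMeasure μ
    have hU : (0 : ℝ) < U := by exact_mod_cast (user 0 ω).pos
    have hN : c ≤ H / U := (le_div_iff₀ hU).2 hH
    have hHU : (H : ℝ) = U * (H / U) := by field_simp
    have hsqrt : √((U : ℝ) * H) = U * √(H / U) := by
      conv_lhs => rw [hHU, ← mul_assoc, Real.sqrt_mul (by positivity), Real.sqrt_mul_self hU.le]
    rw [hsqrt]
    refine final_bound hc hN (by exact_mod_cast hr) hU.le ?_ ?_
    · rw [← hHU]
      exact hinst.integral_pathRegret_le_two_mul hI.measurable_choice H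
    · exact integral_pathRegret_le hinst hI hr hΛ hpar hdet H (by linarith) hHU
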